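/- Let $(Y_k)_k$ and $(Y'_k)_k$ be two independent sequences of independent standard Gaussian random variables, let $a_0>0$ and $p_0\in\mathbb R$, and for $n\in\mathbb N$ let $$x^{(n)}_t=\sum_{k=1}^n \frac{a_0}{k^{p_0}}\bigl(Y_k\sin(2k\pi t)+Y'_k\cos(2k\pi t)\bigr),\qquad t\in[0,1].$$ The sample of size $n$ consists of the Fourier coefficients $y^{(1)}_k=2\int_0^1 x^{(n)}_t\sin(2k\pi t)\,dt=\frac{a_0}{k^{p_0}}Y_k$ and $y^{(2)}_k=2\int_0^1 x^{(n)}_t\cos(2k\pi t)\,dt=\frac{a_0}{k^{p_0}}Y'_k$, $k=1,\dots,n$. Put $o_k=(y_k^{(1)})^2+(y_k^{(2)})^2$. The log-likelihood of the parameters $a>0$, $p\in\mathbb R$ is $$\ell_n(a,p)=-n\log(2\pi)-2n\log a+2p\sum_{k=1}^n\log k-\frac1{2a^2}\sum_{k=1}^n k^{2p}o_k ,$$ and $$\frac{\partial \ell_n}{\partial a}=-\frac{2n}{a}+\frac1{a^3}\sum_{k=1}^n k^{2p}o_k,\qquad \frac{\partial \ell_n}{\partial p}=\sum_{k=1}^n\log(k)\Bigl(2-\frac{k^{2p}o_k}{a^2}\Bigr).$$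 There are measurable functions $\tilde p_n,\tilde a_n$ of the sample and of the parameter $a_0$ (but not of $p_0$), and measurable functions $\hat a_n,\hat p_n$ of the sample alone, such that for all $a_0>0$ and $p_0\in\mathbb R$ the following hold. (1) ($a_0$ known.) Almost surely, for every $n$, $\tilde p_n$ is a zero of $p\mapsto\frac{\partial \ell_n}{\partial p}(a_0,p)$ and maximizes $p\mapsto \ell_n(a_0,p)$ over $\mathbb R$. Moreover $$\tilde p_n\xrightarrow[n\to\infty]{a.s.}p_0,\qquad 2\sqrt{\textstyle\sum_{k=1}^n\log^2 k}\;(\tilde p_n-p_0)\xrightarrow[n\to\infty]{L}N(0,1).$$ (2) (Both parameters unknown.) Almost surely, for every $n$, $\hat a_n>0$, $\frac{\partial \ell_n}{\partial a}(\hat a_n,\hat p_n)=\frac{\partial \ell_n}{\partial p}(\hat a_n,\hat p_n)=0$, and $(\hat a_n,\hat p_n)$ maximizes $\ell_n$ over $(0,\infty)\times\mathbb R$. Moreover $\hat p_n\to p_0$ almost surely, and $$2\begin{pmatrix}\frac{\sqrt n}{a_0} & -\frac{\sum_{k=1}^n\log k}{\sqrt n}\\[4pt] -\frac{\sum_{k=1}^n\log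 k}{a_0\sqrt{\sum_{k=1}^n\log^2k}} & \sqrt{\sum_{k=1}^n\log^2k}\end{pmatrix}\begin{pmatrix}\hat a_n-a_0\\ \hat p_n-p_0\end{pmatrix}\xrightarrow[n\to\infty]{L}\begin{pmatrix}1\\-1\end{pmatrix}Z,$$ where $Z$ is a standard Gaussian variable; so the two normalized components are asymptotically perfectly (negatively) correlated. (3) Almost surely, for every $n$, $\tilde a_n>0$ and $\frac{\partial \ell_n}{\partial a}(\tilde a_n,\tilde p_n)=0$; and the convergence in law displayed in (2) also holds with $(\tilde a_n,\tilde p_n)$ in place of $(\hat a_n,\hat p_n)$. -/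

import Mathlib

open MeasureTheory ProbabilityTheory Filter Topology
open scoped NNReal

namespace PeriodicGaussian

/-- A path of the process
`x_t = ∑_{k=1}^n (a / k^p) (u_k sin(2kπt) + v_k cos(2kπt))`;
`u` and `v` are the values taken by the two sequences of Gaussian variables. -/
noncomputable def modelPath (n : ℕ) (a p : ℝ) (u v : ℕ → ℝ) (t : ℝ) : ℝ :=
  ∑ k ∈ Finset.Icc 1 n, a / (k : ℝ) ^ p *
    (u k * Real.sin (2 * k * Real.pi * t) + v k * Real.cos (2 * k * Real.pi * t))

/-- A sample of size `n`: one pair `(y_k^{(1)}, y_k^{(2)})` for each harmonic `k = 1, …, n`. -/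
abbrev Sample (n : ℕ) : Type := Finset.Icc 1 n → ℝ × ℝ

/-- The sample extracted from a path: its sine and cosine Fourier coefficients of
order `1, …, n`. -/
noncomputable def fourierSample (n : ℕ) (x : ℝ → ℝ) : Sample n := fun k =>
  (2 * ∫ t in (0 : ℝ)..1, x t * Real.sin (2 * ((k : ℕ) : ℝ) * Real.pi * t),
   2 * ∫ t in (0 : ℝ)..1, x t * Real.cos (2 * ((k : ℕ) : ℝ) * Real.pi * t))

/-- `o_k = (y_k^{(1)})² + (y_k^{(2)})²`. -/
def power {n : ℕ} (y : Sample n) (k : Finset.Icc 1 n) : ℝ := (y k).1 ^ 2 + (y k).2 ^ 2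

/-- `∑_{k=1}^n log k`. -/
noncomputable def sumLog (n : ℕ) : ℝ := ∑ k ∈ Finset.Icc 1 n, Real.log k

/-- `∑_{k=1}^n log² k`. -/
noncomputable def sumLogSq (n : ℕ) : ℝ := ∑ k ∈ Finset.Icc 1 n, Real.log k ^ 2

/-- The log-likelihood `ℓ_n(a, p)` of the sample `y`. -/
noncomputable def logLikelihood {n : ℕ} (y : Sample n) (a p : ℝ) : ℝ :=
  -n * Real.log (2 * Real.pi) - 2 * n * Real.log a + 2 * p * sumLog n
    - 1 / (2 * a ^ 2) * ∑ k : Finset.Icc 1 n, ((k : ℕ) : ℝ) ^ (2 * p) * power y k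

/-- The partial derivative `∂ℓ_n/∂a`. -/
noncomputable def scoreA {n : ℕ} (y : Sample n) (a p : ℝ) : ℝ :=
  -(2 * n) / a + 1 / a ^ 3 * ∑ k : Finset.Icc 1 n, ((k : ℕ) : ℝ) ^ (2 * p) * power y k

/-- The partial derivative `∂ℓ_n/∂p`. -/
noncomputable def scoreP {n : ℕ} (y : Sample n) (a p : ℝ) : ℝ :=
  ∑ k : Finset.Icc 1 n,
    Real.log ((k : ℕ) : ℝ) * (2 - ((k : ℕ) : ℝ) ^ (2 * p) * power y k / a ^ 2)

/-- The matrix that multiplies `(â_n - a₀, p̂_n - p₀)` in the joint limit theorem. -/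
noncomputable def normMatrix (n : ℕ) (a₀ : ℝ) : Matrix (Fin 2) (Fin 2) ℝ :=
  (2 : ℝ) • !![Real.sqrt n / a₀, -(sumLog n / Real.sqrt n);
               -(sumLog n / (a₀ * Real.sqrt (sumLogSq n))), Real.sqrt (sumLogSq n)]

/-! The functions above are what their names say: `logLikelihood` is the logarithm of the
joint Gaussian density, and the scores are its partial derivatives. -/

lemma pos_of_mem {n : ℕ} (k : Finset.Icc 1 n) : (0 : ℝ) < ((k : ℕ) : ℝ) := by
  exact_mod_cast (Finset.mem_Icc.mp k.2).1

lemma logLikelihood_eq_log_density {n : ℕ} (y : Sample n) {a : ℝ} (ha : 0 < a) (p : ℝ) :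
    logLikelihood y a p = Real.log (∏ k : Finset.Icc 1 n,
      (gaussianPDFReal 0 (Real.toNNReal ((a / ((k : ℕ) : ℝ) ^ p) ^ 2)) (y k).1 *
       gaussianPDFReal 0 (Real.toNNReal ((a / ((k : ℕ) : ℝ) ^ p) ^ 2)) (y k).2)) := by
  have hpi := Real.pi_pos
  have key : ∀ k : Finset.Icc 1 n, ∀ x : ℝ,
      0 < gaussianPDFReal 0 (Real.toNNReal ((a / ((k : ℕ) : ℝ) ^ p) ^ 2)) x ∧
      Real.log (gaussianPDFReal 0 (Real.toNNReal ((a / ((k : ℕ) : ℝ) ^ p) ^ 2)) x)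
        = -(Real.log (2 * Real.pi) / 2) - Real.log a + p * Real.log ((k : ℕ) : ℝ)
          - 1 / (2 * a ^ 2) * (((k : ℕ) : ℝ) ^ (2 * p) * x ^ 2) := by
    intro k x
    have hk := pos_of_mem k
    have hkp : 0 < ((k : ℕ) : ℝ) ^ p := Real.rpow_pos_of_pos hk p
    have hs : 0 < (a / ((k : ℕ) : ℝ) ^ p) ^ 2 := by positivity
    refine ⟨gaussianPDFReal_pos _ _ _ (by simpa using ⟨ha.ne', hkp.ne'⟩), ?_⟩
    rw [gaussianPDFReal, Real.coe_toNNReal _ hs.le,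
      Real.log_mul (by positivity) (Real.exp_pos _).ne', Real.log_exp, Real.log_inv,
      Real.log_sqrt (by positivity), Real.log_mul (by positivity) hs.ne', Real.log_pow,
      Real.log_div ha.ne' hkp.ne', Real.log_rpow hk]
    have h2 : ((k : ℕ) : ℝ) ^ (2 * p) = (((k : ℕ) : ℝ) ^ p) ^ 2 := by
      rw [mul_comm, Real.rpow_mul hk.le]; norm_num
    rw [h2]
    field_simp
    push_cast
    ring
  rw [Real.log_prod fun k _ => (mul_pos (key k _).1 (key k _).1).ne']
  rw [Finset.sum_congr rfl fun k _ => by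
    rw [Real.log_mul (key k _).1.ne' (key k _).1.ne', (key k _).2, (key k _).2]]
  have hsum : sumLog n = ∑ k : Finset.Icc 1 n, Real.log ((k : ℕ) : ℝ) := by
    rw [sumLog, ← Finset.sum_coe_sort]
  have hcard : (n : ℝ) = ∑ _k : Finset.Icc 1 n, (1 : ℝ) := by simp
  rw [logLikelihood, hsum]
  nth_rewrite 1 2 [hcard]
  simp only [power, Finset.mul_sum, neg_mul, Finset.sum_mul, ← Finset.sum_sub_distrib,
    ← Finset.sum_add_distrib, ← Finset.sum_neg_distrib]
  refine Finset.sum_congr rfl fun k _ => ?_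
  ring

lemma hasDerivAt_logLikelihood_a {n : ℕ} (y : Sample n) {a : ℝ} (ha : 0 < a) (p : ℝ) :
    HasDerivAt (fun a => logLikelihood y a p) (scoreA y a p) a := by
  have h1 := (Real.hasDerivAt_log ha.ne').const_mul (2 * (n : ℝ))
  have h2 : HasDerivAt (fun a : ℝ => 1 / (2 * a ^ 2)) (-(1 / a ^ 3)) a := by
    have h3 := ((hasDerivAt_pow 2 a).const_mul 2).inv (by positivity)
    refine (h3.congr_deriv ?_).congr_of_eventuallyEq (Eventually.of_forall fun x => ?_)
    · field_simp
      norm_num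
    · simp
  have := (((hasDerivAt_const a (-(n : ℝ) * Real.log (2 * Real.pi))).sub h1).add
    (hasDerivAt_const a (2 * p * sumLog n))).sub (h2.mul_const
      (∑ k : Finset.Icc 1 n, ((k : ℕ) : ℝ) ^ (2 * p) * power y k))
  refine this.congr_deriv ?_
  rw [scoreA]
  field_simp
  ring

lemma hasDerivAt_logLikelihood_p {n : ℕ} (y : Sample n) (a p : ℝ) :
    HasDerivAt (fun p => logLikelihood y a p) (scoreP y a p) p := by
  have h1 : ∀ k : Finset.Icc 1 n, HasDerivAt
      (fun p : ℝ => ((k : ℕ) : ℝ) ^ (2 * p) * power y k)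
      (((k : ℕ) : ℝ) ^ (2 * p) * (2 * Real.log ((k : ℕ) : ℝ)) * power y k) p := by
    intro k
    have := (((hasDerivAt_id p).const_mul 2).const_rpow (pos_of_mem k)).mul_const (power y k)
    refine this.congr_deriv ?_
    simp only [id]
    ring
  have h2 := HasDerivAt.fun_sum (u := Finset.univ) fun k _ => h1 k
  have h3 := ((((hasDerivAt_id p).const_mul 2).mul_const (sumLog n)).const_add
    (-(n : ℝ) * Real.log (2 * Real.pi) - 2 * n * Real.log a)).sub
      (h2.const_mul (1 / (2 * a ^ 2)))
  refine h3.congr_deriv ?_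
  have hsum : sumLog n = ∑ k : Finset.Icc 1 n, Real.log ((k : ℕ) : ℝ) := by
    rw [sumLog, ← Finset.sum_coe_sort]
  rw [scoreP, hsum, Finset.mul_sum, Finset.mul_sum, ← Finset.sum_sub_distrib]
  refine Finset.sum_congr rfl fun k _ => ?_
  by_cases ha : a = 0
  · subst ha; simp; ring
  · field_simp

/-! The sample extracted from a path of the model is `y_k^{(1)} = (a / k^p) u_k`,
`y_k^{(2)} = (a / k^p) v_k`. -/

lemma integral_cos_two_pi (m : ℤ) :
    ∫ t in (0 : ℝ)..1, Real.cos (2 * m * Real.pi * t) = if m = 0 then 1 else 0 := by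
  split_ifs with h
  · simp [h]
  · have hc : (2 * m * Real.pi : ℝ) ≠ 0 := by
      have : (m : ℝ) ≠ 0 := by exact_mod_cast h
      positivity
    rw [intervalIntegral.integral_comp_mul_left (fun x => Real.cos x) hc, integral_cos]
    have : Real.sin (2 * m * Real.pi) = 0 := by
      have := Real.sin_int_mul_pi (2 * m)
      push_cast at this
      exact this
    simp [this]

lemma integral_sin_two_pi (m : ℤ) :
    ∫ t in (0 : ℝ)..1, Real.sin (2 * m * Real.pi * t) = 0 := by
  by_cases h : m = 0
  · simp [h]
  · have hc : (2 * m * Real.pi : ℝ) ≠ 0 := by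
      have : (m : ℝ) ≠ 0 := by exact_mod_cast h
      positivity
    rw [intervalIntegral.integral_comp_mul_left (fun x => Real.sin x) hc, integral_sin]
    have : Real.cos (2 * m * Real.pi) = 1 := by
      have := Real.cos_int_mul_two_pi m
      rw [← this]; congr 1; ring
    simp [this]

lemma fourierSample_modelPath (n : ℕ) (a p : ℝ) (u v : ℕ → ℝ) (k : Finset.Icc 1 n) :
    fourierSample n (modelPath n a p u v) k =
      (a / ((k : ℕ) : ℝ) ^ p * u k, a / ((k : ℕ) : ℝ) ^ p * v k) := by
  obtain ⟨k, hk⟩ := k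
  have hk1 := (Finset.mem_Icc.mp hk).1
  have hcont : ∀ m : ℤ, IntervalIntegrable (fun t => Real.cos (2 * m * Real.pi * t))
      volume 0 1 := fun m => by apply Continuous.intervalIntegrable; fun_prop
  have hcont' : ∀ m : ℤ, IntervalIntegrable (fun t => Real.sin (2 * m * Real.pi * t))
      volume 0 1 := fun m => by apply Continuous.intervalIntegrable; fun_prop
  have e1 : ∀ j ∈ Finset.Icc 1 n, 2 * ∫ t in (0 : ℝ)..1, (a / (j : ℝ) ^ p *
      (u j * Real.sin (2 * j * Real.pi * t) + v j * Real.cos (2 * j * Real.pi * t))) *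
        Real.sin (2 * k * Real.pi * t) = if j = k then a / (j : ℝ) ^ p * u j else 0 := by
    intro j _
    have : ∀ t : ℝ, (a / (j : ℝ) ^ p *
      (u j * Real.sin (2 * j * Real.pi * t) + v j * Real.cos (2 * j * Real.pi * t))) *
        Real.sin (2 * k * Real.pi * t) =
        (a / (j : ℝ) ^ p * u j / 2) * (Real.cos (2 * ((j - k : ℤ) : ℝ) * Real.pi * t) -
          Real.cos (2 * ((j + k : ℤ) : ℝ) * Real.pi * t)) +
        (a / (j : ℝ) ^ p * v j / 2) * (Real.sin (2 * ((j + k : ℤ) : ℝ) * Real.pi * t) -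
          Real.sin (2 * ((j - k : ℤ) : ℝ) * Real.pi * t)) := by
      intro t
      push_cast
      rw [show 2 * ((j : ℝ) - k) * Real.pi * t =
          2 * j * Real.pi * t - 2 * k * Real.pi * t by ring,
        show 2 * ((j : ℝ) + k) * Real.pi * t =
          2 * j * Real.pi * t + 2 * k * Real.pi * t by ring,
        Real.cos_sub, Real.cos_add, Real.sin_add, Real.sin_sub]
      ring
    simp_rw [this]
    rw [intervalIntegral.integral_add (((hcont _).sub (hcont _)).const_mul _)
        (((hcont' _).sub (hcont' _)).const_mul _),
      intervalIntegral.integral_const_mul, intervalIntegral.integral_const_mul,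
      intervalIntegral.integral_sub (hcont _) (hcont _),
      intervalIntegral.integral_sub (hcont' _) (hcont' _)]
    simp only [integral_cos_two_pi, integral_sin_two_pi]
    split_ifs <;> first | omega | ring
  have e2 : ∀ j ∈ Finset.Icc 1 n, 2 * ∫ t in (0 : ℝ)..1, (a / (j : ℝ) ^ p *
      (u j * Real.sin (2 * j * Real.pi * t) + v j * Real.cos (2 * j * Real.pi * t))) *
        Real.cos (2 * k * Real.pi * t) = if j = k then a / (j : ℝ) ^ p * v j else 0 := by
    intro j _
    have : ∀ t : ℝ, (a / (j : ℝ) ^ p *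
      (u j * Real.sin (2 * j * Real.pi * t) + v j * Real.cos (2 * j * Real.pi * t))) *
        Real.cos (2 * k * Real.pi * t) =
        (a / (j : ℝ) ^ p * v j / 2) * (Real.cos (2 * ((j - k : ℤ) : ℝ) * Real.pi * t) +
          Real.cos (2 * ((j + k : ℤ) : ℝ) * Real.pi * t)) +
        (a / (j : ℝ) ^ p * u j / 2) * (Real.sin (2 * ((j + k : ℤ) : ℝ) * Real.pi * t) +
          Real.sin (2 * ((j - k : ℤ) : ℝ) * Real.pi * t)) := by
      intro t
      push_cast
      rw [show 2 * ((j : ℝ) - k) * Real.pi * t =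
          2 * j * Real.pi * t - 2 * k * Real.pi * t by ring,
        show 2 * ((j : ℝ) + k) * Real.pi * t =
          2 * j * Real.pi * t + 2 * k * Real.pi * t by ring,
        Real.cos_sub, Real.cos_add, Real.sin_add, Real.sin_sub]
      ring
    simp_rw [this]
    rw [intervalIntegral.integral_add (((hcont _).add (hcont _)).const_mul _)
        (((hcont' _).add (hcont' _)).const_mul _),
      intervalIntegral.integral_const_mul, intervalIntegral.integral_const_mul,
      intervalIntegral.integral_add (hcont _) (hcont _),
      intervalIntegral.integral_add (hcont' _) (hcont' _)]
    simp only [integral_cos_two_pi, integral_sin_two_pi]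
    split_ifs <;> first | omega | ring
  simp only [fourierSample, modelPath, Finset.sum_mul]
  rw [intervalIntegral.integral_finsetSum
      (fun j _ => by apply Continuous.intervalIntegrable; fun_prop),
    intervalIntegral.integral_finsetSum
      (fun j _ => by apply Continuous.intervalIntegrable; fun_prop),
    Finset.mul_sum, Finset.mul_sum, Finset.sum_congr rfl e1, Finset.sum_congr rfl e2,
    Finset.sum_ite_eq', Finset.sum_ite_eq', if_pos hk, if_pos hk]

end PeriodicGaussian

/-!
Write `q = p - p₀` and `z k = (Y k ^ 2 + Y' k ^ 2) / 2`. The variables `z k` are independent, with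
mean `1` and variance `1`, and `k ^ (2 * p) * power y k = 2 * a₀ ^ 2 * (k ^ (2 * q) * z k)`, so that
the scores become exponential sums in `q` with random weights `z k`.

**Estimators.** The inequality `exp x ≥ 1 + x` shows that the log-likelihood is concave in
`(log a, p)` (`logLikelihood_sub_le`); hence zeros of the scores are global maximizers. With `a`
known, the score in `p` is a strictly monotone exponential sum, which has exactly one zero. With
both parameters unknown, `a` is eliminated through the score in `a`, and `p` solves the profile
equation `∑ k, (log k - m) * k ^ (2 * q) * z k = 0`, where `m` is the mean of `log 1, …, log n`;
after division by `exp (2 * q * m)` this is again a strictly monotone exponential sum. Monotonicity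
also gives measurability of the roots (`measurable_expRoot`).

**Logarithmic weights.** The gaps `log n - log k` are bounded in mean square (`sum_log_gap_sq_le`):
most frequencies have a logarithm within `O(1)` of `log n`. Therefore
`∑ log k * (z k - 1) = √n * log n * (fluct z n - gapFluct z n)`, where `fluct z n` is the plain
normalized sum of the `z k - 1` and the remainder `gapFluct z n` tends to `0` in probability.
Summation by parts reduces weighted averages of `z` to the strong law of large numbers.

**Consistency and rates.** Deterministic inequalities bound a root by the score at the true
parameter, with no smallness assumption on the root (`abs_mul_sum_le_of_root`,
`abs_mul_le_of_joint_root`). They give almost sure consistency, and `q = o(log n / √n)` in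
probability for both estimators. For known `a` the score may then be linearized, and
`2 * √(sumLogSq n) * q + fluct z n` tends to `0` (`tendsto_normalized_add_fluct`).

**Joint limit.** The rate `o(log n / √n)` is all that is needed of the exponent: completing it by
the zero of the score in `a` gives a scale for which the first row of the normalized error is
`fluct z n + o(1)`. The two components of the score have correlation
`sumLog n / √(n * sumLogSq n)`, which tends to `1` because the empirical variance of the logarithms
is bounded while their mean square grows like `log² n`. For this reason the second row is the
opposite of the first one, up to `o(1)` (`tendsto_normalized_errors`), and both the joint estimator
and the estimator with known scale share the same degenerate limit.

The expansions are proved for a fixed sequence `z` along an arbitrary filter below `atTop` on which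
`fluct z n / log n` and `gapFluct z n` tend to `0`; these two limits hold in probability, and
the subsequence principle `tendstoInMeasure_of_forall_filter` carries the conclusions over to
convergence in probability. Slutsky's theorem and the central limit theorem for `fluct` conclude.
-/

namespace PeriodicGaussian

/-! ### Exponential sums and their roots -/

section ExponentialSums

variable {ι : Type*} [Fintype ι]

/-- The exponential sum `p ↦ ∑ i, b i * exp (2 * b i * p) * w i`. -/
noncomputable def expSum (b w : ι → ℝ) (p : ℝ) : ℝ := ∑ i, b i * Real.exp (2 * b i * p) * w i

lemma continuous_expSum (b w : ι → ℝ) : Continuous (expSum b w) := by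
  unfold expSum; fun_prop

lemma mul_exp_two_mul_le {b p p' : ℝ} (h : p ≤ p') :
    b * Real.exp (2 * b * p) ≤ b * Real.exp (2 * b * p') := by
  rcases le_total 0 b with hb | hb
  · exact mul_le_mul_of_nonneg_left (Real.exp_le_exp.2 (by nlinarith)) hb
  · exact mul_le_mul_of_nonpos_left (Real.exp_le_exp.2 (by nlinarith)) hb

lemma mul_exp_two_mul_lt {b p p' : ℝ} (hb : b ≠ 0) (h : p < p') :
    b * Real.exp (2 * b * p) < b * Real.exp (2 * b * p') := by
  rcases lt_or_gt_of_ne hb with hb | hb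
  · exact mul_lt_mul_of_neg_left (Real.exp_lt_exp.2 (by nlinarith)) hb
  · exact mul_lt_mul_of_pos_left (Real.exp_lt_exp.2 (by nlinarith)) hb

lemma strictMono_expSum {b w : ι → ℝ} (hb : ∃ i, b i ≠ 0) (hw : ∀ i, 0 < w i) :
    StrictMono (expSum b w) := by
  obtain ⟨i, hi⟩ := hb
  intro p p' h
  exact Finset.sum_lt_sum
    (fun j _ => mul_le_mul_of_nonneg_right (mul_exp_two_mul_le h.le) (hw j).le)
    ⟨i, Finset.mem_univ _, mul_lt_mul_of_pos_right (mul_exp_two_mul_lt hi h) (hw i)⟩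

lemma exists_lt_expSum {b w : ι → ℝ} (hb : ∃ i, 0 < b i) (hw : ∀ i, 0 < w i) (D : ℝ) :
    ∃ p, D < expSum b w p := by
  obtain ⟨i, hi⟩ := hb
  -- `exp x ≥ 1 + x` makes the sum grow at least linearly on `[0, ∞)`
  have hgrow : ∀ p, 0 ≤ p → ∑ j, b j * w j + 2 * b i ^ 2 * w i * p ≤ expSum b w p := by
    intro p hp
    have h1 : ∀ j, b j * w j ≤ b j * Real.exp (2 * b j * p) * w j := by
      intro j
      have := mul_le_mul_of_nonneg_right (mul_exp_two_mul_le (b := b j) hp) (hw j).le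
      simpa using this
    have h2 : b i * w i + 2 * b i ^ 2 * w i * p ≤ b i * Real.exp (2 * b i * p) * w i := by
      have h3 := Real.add_one_le_exp (2 * b i * p)
      have h4 : 0 < b i * w i := mul_pos hi (hw i)
      nlinarith
    classical
    unfold expSum
    rw [← Finset.add_sum_erase _ _ (Finset.mem_univ i),
      ← Finset.add_sum_erase (a := i) (f := fun j => b j * Real.exp (2 * b j * p) * w j) _
        (Finset.mem_univ i)]
    have := Finset.sum_le_sum fun j (_ : j ∈ Finset.univ.erase i) => h1 j
    linarith
  have hc : 0 < 2 * b i ^ 2 * w i := by have := hw i; positivity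
  refine ⟨(|D| + |∑ j, b j * w j| + 1) / (2 * b i ^ 2 * w i),
    lt_of_lt_of_le ?_ (hgrow _ (by positivity))⟩
  rw [mul_div_cancel₀ _ hc.ne']
  have := le_abs_self D
  have := neg_abs_le (∑ j, b j * w j)
  linarith

lemma expSum_neg (b w : ι → ℝ) (p : ℝ) : expSum (-b) w p = -expSum b w (-p) := by
  simp [expSum, Finset.sum_neg_distrib]

lemma exists_expSum_lt_of_neg {b w : ι → ℝ} (hb : ∃ i, b i < 0) (hw : ∀ i, 0 < w i) (D : ℝ) :
    ∃ p, expSum b w p < D := by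
  obtain ⟨p, hp⟩ := exists_lt_expSum (b := -b) (by simpa using hb) hw (-D)
  rw [expSum_neg] at hp
  exact ⟨-p, by linarith⟩

lemma exists_expSum_lt_of_nonneg {b : ι → ℝ} (w : ι → ℝ) (hb : ∀ i, 0 ≤ b i) {D : ℝ}
    (hD : 0 < D) : ∃ p, expSum b w p < D := by
  have h : Tendsto (expSum b w) atBot (𝓝 (∑ _i : ι, (0 : ℝ))) := by
    refine tendsto_finsetSum _ fun i _ => ?_
    rcases (hb i).eq_or_lt with h0 | h0
    · simp [← h0]
    · have h1 : Tendsto (fun p : ℝ => Real.exp (2 * b i * p)) atBot (𝓝 0) :=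
        Real.tendsto_exp_atBot.comp (tendsto_id.const_mul_atBot (by positivity))
      simpa using (h1.const_mul (b i)).mul_const (w i)
  rw [Finset.sum_const_zero] at h
  exact (h.eventually_lt_const hD).exists

lemma exists_expSum_eq {b w : ι → ℝ} {D p p' : ℝ} (h : expSum b w p < D) (h' : D < expSum b w p') :
    ∃ x, expSum b w x = D :=
  mem_range_of_exists_le_of_exists_ge (continuous_expSum b w) ⟨p, h.le⟩ ⟨p', h'.le⟩

open Classical in
/-- The solution `p` of `expSum b w p = D` when all weights are positive and a solution exists;
`0` otherwise. -/
noncomputable def expRoot (b : ι → ℝ) (D : ℝ) (w : ι → ℝ) : ℝ :=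
  if h : (∀ i, 0 < w i) ∧ ∃ p, expSum b w p = D then h.2.choose else 0

lemma expSum_expRoot {b w : ι → ℝ} {D : ℝ} (hw : ∀ i, 0 < w i) (h : ∃ p, expSum b w p = D) :
    expSum b w (expRoot b D w) = D := by
  rw [expRoot, dif_pos ⟨hw, h⟩]
  exact h.choose_spec

/-- Since the exponential sum increases strictly, its root lies below `c` exactly when the value
at `c` exceeds `D`, which is a measurable condition on the weights. -/
lemma measurable_expRoot {b : ι → ℝ} {D : ℝ} (hb : ∃ i, b i ≠ 0)
    (hex : ∀ w : ι → ℝ, (∀ i, 0 < w i) → ∃ p, expSum b w p = D) : Measurable (expRoot b D) := by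
  have hG : MeasurableSet {w : ι → ℝ | ∀ i, 0 < w i} := by
    simp only [Set.ofPred_forall]
    exact MeasurableSet.iInter fun i => measurableSet_lt measurable_const (measurable_pi_apply i)
  have hF : ∀ c, MeasurableSet {w : ι → ℝ | D < expSum b w c} := fun c =>
    measurableSet_lt measurable_const (by unfold expSum; fun_prop)
  refine measurable_of_Iio fun c => ?_
  have : expRoot b D ⁻¹' Set.Iio c = ({w : ι → ℝ | ∀ i, 0 < w i} ∩ {w | D < expSum b w c}) ∪
      ({w : ι → ℝ | ∀ i, 0 < w i}ᶜ ∩ {_w | 0 < c}) := by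
    ext w
    by_cases hw : ∀ i, 0 < w i
    · have h1 := expSum_expRoot hw (hex w hw)
      have h2 := (strictMono_expSum hb hw).lt_iff_lt (a := expRoot b D w) (b := c)
      rw [h1] at h2
      simp [hw, h2]
    · have : expRoot b D w = 0 := by rw [expRoot, dif_neg fun h => hw h.1]
      simp [hw, this]
  rw [this]
  exact (hG.inter (hF c)).union (hG.compl.inter (MeasurableSet.const _))

end ExponentialSums

/-! ### The estimators as roots of the scores -/

section Estimators

variable {n : ℕ}

lemma rpow_two_mul_eq_exp (k : Finset.Icc 1 n) (p : ℝ) :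
    ((k : ℕ) : ℝ) ^ (2 * p) = Real.exp (2 * Real.log ((k : ℕ) : ℝ) * p) := by
  rw [Real.rpow_def_of_pos (pos_of_mem k)]
  congr 1; ring

lemma log_nonneg_of_mem (k : Finset.Icc 1 n) : 0 ≤ Real.log ((k : ℕ) : ℝ) :=
  Real.log_natCast_nonneg _

lemma sumLog_eq_sum_coe (n : ℕ) : sumLog n = ∑ k : Finset.Icc 1 n, Real.log ((k : ℕ) : ℝ) := by
  rw [sumLog, ← Finset.sum_coe_sort]

lemma power_nonneg (y : Sample n) (k : Finset.Icc 1 n) : 0 ≤ power y k := by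
  unfold power; positivity

@[fun_prop]
lemma measurable_power : Measurable fun y : Sample n => power y := by
  unfold power
  fun_prop

/-- The log-likelihood is concave in `(log a, p)`: it lies below its tangent planes. Hence any zero
of the score is a global maximizer. -/
lemma logLikelihood_sub_le (y : Sample n) {a a' : ℝ} (ha : 0 < a) (ha' : 0 < a') (p p' : ℝ) :
    logLikelihood y a p - logLikelihood y a' p' ≤
      (Real.log a - Real.log a') * (a' * scoreA y a' p') + (p - p') * scoreP y a' p' := by
  have hterm : ∀ k : Finset.Icc 1 n,
      ((k : ℕ) : ℝ) ^ (2 * p') * power y k / a' ^ 2 *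
        (1 + 2 * (p - p') * Real.log ((k : ℕ) : ℝ) - 2 * (Real.log a - Real.log a')) ≤
      ((k : ℕ) : ℝ) ^ (2 * p) * power y k / a ^ 2 := by
    intro k
    have h0 : ((k : ℕ) : ℝ) ^ (2 * p) * power y k / a ^ 2 =
        ((k : ℕ) : ℝ) ^ (2 * p') * power y k / a' ^ 2 *
          Real.exp (2 * (p - p') * Real.log ((k : ℕ) : ℝ) - 2 * (Real.log a - Real.log a')) := by
      have e : ∀ x : ℝ, 0 < x → Real.exp (-2 * Real.log x) = 1 / x ^ 2 := by
        intro x hx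
        rw [show -2 * Real.log x = -(Real.log x + Real.log x) by ring, Real.exp_neg, Real.exp_add,
          Real.exp_log hx, one_div, sq]
      have e1 := e a ha
      have e2 : Real.exp (2 * Real.log a') = a' ^ 2 := by
        rw [two_mul, Real.exp_add, Real.exp_log ha', sq]
      rw [show 2 * (p - p') * Real.log ((k : ℕ) : ℝ) - 2 * (Real.log a - Real.log a') =
        (2 * Real.log ((k : ℕ) : ℝ) * p - 2 * Real.log ((k : ℕ) : ℝ) * p') +
          (-2 * Real.log a + 2 * Real.log a') by ring, Real.exp_add, Real.exp_add, Real.exp_sub,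
        e1, e2, rpow_two_mul_eq_exp, rpow_two_mul_eq_exp]
      field_simp
    rw [h0]
    refine mul_le_mul_of_nonneg_left ?_ ?_
    · have := Real.add_one_le_exp
        (2 * (p - p') * Real.log ((k : ℕ) : ℝ) - 2 * (Real.log a - Real.log a'))
      linarith
    · have := power_nonneg y k
      have := Real.rpow_nonneg (pos_of_mem k).le (2 * p')
      positivity
  have hsum := Finset.sum_le_sum fun k (_ : k ∈ Finset.univ) => hterm k
  have hA : a' * scoreA y a' p' = -(2 * n) +
      ∑ k : Finset.Icc 1 n, ((k : ℕ) : ℝ) ^ (2 * p') * power y k / a' ^ 2 := by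
    rw [scoreA, ← Finset.sum_div]
    field_simp
  have hP : scoreP y a' p' = 2 * sumLog n - ∑ k : Finset.Icc 1 n,
      Real.log ((k : ℕ) : ℝ) * (((k : ℕ) : ℝ) ^ (2 * p') * power y k / a' ^ 2) := by
    rw [scoreP, sumLog_eq_sum_coe, Finset.mul_sum, ← Finset.sum_sub_distrib]
    exact Finset.sum_congr rfl fun k _ => by ring
  have hl : ∀ x r : ℝ, 0 < x → logLikelihood y x r = -n * Real.log (2 * Real.pi) -
      2 * n * Real.log x + 2 * r * sumLog n -
        (∑ k : Finset.Icc 1 n, ((k : ℕ) : ℝ) ^ (2 * r) * power y k / x ^ 2) / 2 := by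
    intro x r hx
    rw [logLikelihood, ← Finset.sum_div]
    field_simp
  have hL : ∑ k : Finset.Icc 1 n, ((k : ℕ) : ℝ) ^ (2 * p') * power y k / a' ^ 2 *
        (1 + 2 * (p - p') * Real.log ((k : ℕ) : ℝ) - 2 * (Real.log a - Real.log a')) =
      (1 - 2 * (Real.log a - Real.log a')) *
        ∑ k : Finset.Icc 1 n, ((k : ℕ) : ℝ) ^ (2 * p') * power y k / a' ^ 2 +
      2 * (p - p') * ∑ k : Finset.Icc 1 n,
        Real.log ((k : ℕ) : ℝ) * (((k : ℕ) : ℝ) ^ (2 * p') * power y k / a' ^ 2) := by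
    rw [Finset.mul_sum, Finset.mul_sum, ← Finset.sum_add_distrib]
    exact Finset.sum_congr rfl fun k _ => by ring
  rw [hl a p ha, hl a' p' ha', hA, hP]
  rw [hL] at hsum
  linarith

lemma sumLog_pos (hn : 2 ≤ n) : 0 < sumLog n :=
  Finset.sum_pos' (fun k _ => Real.log_natCast_nonneg k)
    ⟨2, by simp [hn], Real.log_pos (by norm_num)⟩

lemma sumLog_lt (hn : 2 ≤ n) : sumLog n < n * Real.log n := by
  have : sumLog n < ∑ k ∈ Finset.Icc 1 n, Real.log n := by
    refine Finset.sum_lt_sum (fun k hk => ?_) ⟨1, by simp; omega, ?_⟩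
    · rw [Finset.mem_Icc] at hk
      exact Real.log_le_log (by exact_mod_cast hk.1) (by exact_mod_cast hk.2)
    · simpa using Real.log_pos (by exact_mod_cast hn)
  simpa using this

/-- The exponent `p` estimated with known scale `a`: the zero of `p ↦ scoreP y a p`. For `n ≤ 1`,
where the likelihood does not depend on `p`, and for `a ≤ 0` the value is `0`. -/
noncomputable def expKnownScale (n : ℕ) (a : ℝ) (y : Sample n) : ℝ :=
  if 2 ≤ n ∧ 0 < a then
    expRoot (fun k : Finset.Icc 1 n => Real.log ((k : ℕ) : ℝ)) (2 * a ^ 2 * sumLog n) (power y)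
  else 0

/-- The exponent `p` of the joint maximum likelihood estimator: eliminating `a` through
`scoreA y a p = 0` leaves the equation `∑ k, (log k - sumLog n / n) * k ^ (2 * p) * power y k = 0`,
which is solved here after division by `exp (2 * p * sumLog n / n)`. For `n ≤ 1` the value
is `0`. -/
noncomputable def expJoint (n : ℕ) (y : Sample n) : ℝ :=
  if 2 ≤ n then
    expRoot (fun k : Finset.Icc 1 n => Real.log ((k : ℕ) : ℝ) - sumLog n / n) 0 (power y)
  else 0

/-- The positive zero of `a ↦ scoreA y a p`; the value `1` stands in for degenerate samples. -/
noncomputable def scaleOf (n : ℕ) (p : ℝ) (y : Sample n) : ℝ :=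
  open Classical in if 1 ≤ n ∧ ∀ k, 0 < power y k then
    √((∑ k : Finset.Icc 1 n, ((k : ℕ) : ℝ) ^ (2 * p) * power y k) / (2 * n))
  else 1

lemma exists_root_known (hn : 2 ≤ n) {D : ℝ} (hD : 0 < D) (w : Finset.Icc 1 n → ℝ)
    (hw : ∀ k, 0 < w k) :
    ∃ p, expSum (fun k : Finset.Icc 1 n => Real.log ((k : ℕ) : ℝ)) w p = D := by
  obtain ⟨p, hp⟩ := exists_expSum_lt_of_nonneg w (log_nonneg_of_mem (n := n)) hD
  obtain ⟨p', hp'⟩ := exists_lt_expSum (b := fun k : Finset.Icc 1 n => Real.log ((k : ℕ) : ℝ))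
    ⟨⟨2, by simp [hn]⟩, Real.log_pos (by norm_num)⟩ hw D
  exact exists_expSum_eq hp hp'

lemma exists_root_joint (hn : 2 ≤ n) (w : Finset.Icc 1 n → ℝ) (hw : ∀ k, 0 < w k) :
    ∃ p, expSum (fun k : Finset.Icc 1 n => Real.log ((k : ℕ) : ℝ) - sumLog n / n) w p = 0 := by
  have hn0 : (0 : ℝ) < n := by positivity
  obtain ⟨p, hp⟩ := exists_expSum_lt_of_neg
    (b := fun k : Finset.Icc 1 n => Real.log ((k : ℕ) : ℝ) - sumLog n / n)
    ⟨⟨1, by simp; omega⟩, by simpa using div_pos (sumLog_pos hn) hn0⟩ hw 0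
  obtain ⟨p', hp'⟩ := exists_lt_expSum
    (b := fun k : Finset.Icc 1 n => Real.log ((k : ℕ) : ℝ) - sumLog n / n)
    ⟨⟨n, by simp; omega⟩, by
      simp only [sub_pos]
      rw [div_lt_iff₀ hn0, mul_comm]
      exact sumLog_lt hn⟩ hw 0
  exact exists_expSum_eq hp hp'

lemma measurable_expKnownScale (n : ℕ) (a : ℝ) : Measurable (expKnownScale n a) := by
  unfold expKnownScale
  split_ifs with h
  · have hb : ∃ k : Finset.Icc 1 n, Real.log ((k : ℕ) : ℝ) ≠ 0 :=
      ⟨⟨2, by simp [h.1]⟩, (Real.log_pos (by norm_num)).ne'⟩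
    refine (measurable_expRoot hb fun w hw => ?_).comp measurable_power
    have := sumLog_pos h.1
    have := h.2
    exact exists_root_known h.1 (by positivity) w hw
  · exact measurable_const

lemma measurable_expJoint (n : ℕ) : Measurable (expJoint n) := by
  unfold expJoint
  split_ifs with h
  · have hn0 : (0 : ℝ) < n := by positivity
    refine (measurable_expRoot ⟨⟨1, by simp; omega⟩, ?_⟩ (exists_root_joint h)).comp
      measurable_power
    simpa using ⟨(sumLog_pos h).ne', by omega⟩
  · exact measurable_const

lemma measurable_scaleOf (n : ℕ) {p : Sample n → ℝ} (hp : Measurable p) :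
    Measurable fun y => scaleOf n (p y) y := by
  unfold scaleOf
  have hpow : ∀ k, Measurable fun y : Sample n => power y k := fun k =>
    (measurable_pi_apply k).comp measurable_power
  refine Measurable.ite ?_ ?_ measurable_const
  · have hG : MeasurableSet {y : Sample n | ∀ k, 0 < power y k} := by
      simp only [Set.ofPred_forall]
      exact MeasurableSet.iInter fun k => measurableSet_lt measurable_const (hpow k)
    exact (MeasurableSet.const (1 ≤ n)).inter hG
  · refine Measurable.sqrt (Measurable.div_const (Finset.measurable_fun_sum _ fun k _ => ?_) _)
    exact (measurable_const.pow (hp.const_mul 2)).mul (hpow k)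

/-- For `n ≤ 1` the score in `p` vanishes identically, since `log 1 = 0`; any value is then a
maximum likelihood estimator of the exponent. -/
lemma scoreP_eq_zero_of_lt_two (hn : ¬ 2 ≤ n) (y : Sample n) (a p : ℝ) : scoreP y a p = 0 := by
  refine Finset.sum_eq_zero fun k _ => ?_
  have h := Finset.mem_Icc.1 k.2
  have : (k : ℕ) = 1 := by omega
  simp [this]

lemma scoreP_expKnownScale {a : ℝ} (ha : 0 < a) {y : Sample n} (hy : ∀ k, 0 < power y k) :
    scoreP y a (expKnownScale n a y) = 0 := by
  by_cases hn : 2 ≤ n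
  · have hL := sumLog_pos hn
    have h := expSum_expRoot hy (exists_root_known hn (D := 2 * a ^ 2 * sumLog n) (by positivity)
      (power y) hy)
    rw [expKnownScale, if_pos ⟨hn, ha⟩]
    set p := expRoot (fun k : Finset.Icc 1 n => Real.log ((k : ℕ) : ℝ)) (2 * a ^ 2 * sumLog n)
      (power y)
    have e : scoreP y a p = 2 * sumLog n -
        expSum (fun k : Finset.Icc 1 n => Real.log ((k : ℕ) : ℝ)) (power y) p / a ^ 2 := by
      rw [scoreP, expSum, sumLog_eq_sum_coe, Finset.mul_sum, Finset.sum_div,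
        ← Finset.sum_sub_distrib]
      refine Finset.sum_congr rfl fun k _ => ?_
      rw [rpow_two_mul_eq_exp]
      ring
    rw [e, h]
    field_simp
    ring
  · exact scoreP_eq_zero_of_lt_two hn _ _ _

/-- The equation defining `expJoint`, in terms of powers of the frequencies. -/
lemma sum_expJoint (hn : 2 ≤ n) {y : Sample n} (hy : ∀ k, 0 < power y k) :
    ∑ k : Finset.Icc 1 n, (Real.log ((k : ℕ) : ℝ) - sumLog n / n) *
      (((k : ℕ) : ℝ) ^ (2 * expJoint n y) * power y k) = 0 := by
  have h := expSum_expRoot hy (exists_root_joint hn (power y) hy)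
  rw [expJoint, if_pos hn]
  set p := expRoot (fun k : Finset.Icc 1 n => Real.log ((k : ℕ) : ℝ) - sumLog n / n) 0 (power y)
  have h2 : Real.exp (2 * (sumLog n / n) * p) *
      expSum (fun k : Finset.Icc 1 n => Real.log ((k : ℕ) : ℝ) - sumLog n / n) (power y) p = 0 := by
    rw [h, mul_zero]
  rw [← h2, expSum, Finset.mul_sum]
  refine Finset.sum_congr rfl fun k _ => ?_
  rw [rpow_two_mul_eq_exp, show 2 * Real.log ((k : ℕ) : ℝ) * p = 2 * (sumLog n / n) * p +
    2 * (Real.log ((k : ℕ) : ℝ) - sumLog n / n) * p by ring, Real.exp_add]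
  ring

lemma sum_rpow_mul_power_pos (hn : 1 ≤ n) {y : Sample n} (hy : ∀ k, 0 < power y k) (p : ℝ) :
    0 < ∑ k : Finset.Icc 1 n, ((k : ℕ) : ℝ) ^ (2 * p) * power y k :=
  Finset.sum_pos (fun k _ => mul_pos (Real.rpow_pos_of_pos (pos_of_mem k) _) (hy k))
    ⟨⟨1, by simp [hn]⟩, Finset.mem_univ _⟩

lemma scaleOf_sq (hn : 1 ≤ n) {y : Sample n} (hy : ∀ k, 0 < power y k) (p : ℝ) :
    scaleOf n p y ^ 2 = (∑ k : Finset.Icc 1 n, ((k : ℕ) : ℝ) ^ (2 * p) * power y k) / (2 * n) := by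
  have := sum_rpow_mul_power_pos hn hy p
  rw [scaleOf, if_pos ⟨hn, hy⟩, Real.sq_sqrt (by positivity)]

lemma scaleOf_pos (y : Sample n) (p : ℝ) : 0 < scaleOf n p y := by
  unfold scaleOf
  split_ifs with h
  · have := sum_rpow_mul_power_pos h.1 h.2 p
    have := h.1
    positivity
  · exact one_pos

lemma scoreA_scaleOf {y : Sample n} (hy : ∀ k, 0 < power y k) (p : ℝ) :
    scoreA y (scaleOf n p y) p = 0 := by
  rcases Nat.eq_zero_or_pos n with hn | hn
  · -- for the empty sample the score vanishes identically
    subst hn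
    have hs : ∑ k : Finset.Icc 1 0, ((k : ℕ) : ℝ) ^ (2 * p) * power y k = 0 :=
      Finset.sum_eq_zero fun k _ => by simpa using k.2
    rw [scoreA, hs]
    simp
  · have h0 := scaleOf_pos y p
    have h := scaleOf_sq hn hy p
    have hn0 : (0 : ℝ) < n := by exact_mod_cast hn
    rw [eq_div_iff (by positivity)] at h
    rw [scoreA, ← h]
    field_simp
    ring

lemma scoreP_joint {y : Sample n} (hy : ∀ k, 0 < power y k) :
    scoreP y (scaleOf n (expJoint n y) y) (expJoint n y) = 0 := by
  by_cases hn : 2 ≤ n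
  · have h0 := scaleOf_pos y (expJoint n y)
    have h := scaleOf_sq (by omega) hy (expJoint n y)
    have hs := sum_expJoint hn hy
    have hn0 : (0 : ℝ) < n := by positivity
    set p := expJoint n y
    set a := scaleOf n p y
    have e : scoreP y a p = 2 * sumLog n - (∑ k : Finset.Icc 1 n,
        Real.log ((k : ℕ) : ℝ) * (((k : ℕ) : ℝ) ^ (2 * p) * power y k)) / a ^ 2 := by
      rw [scoreP, sumLog_eq_sum_coe, Finset.mul_sum, Finset.sum_div, ← Finset.sum_sub_distrib]
      exact Finset.sum_congr rfl fun k _ => by ring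
    simp only [sub_mul, Finset.sum_sub_distrib, ← Finset.mul_sum] at hs
    rw [eq_div_iff (by positivity)] at h
    rw [e, sub_eq_zero.1 hs, ← h]
    field_simp
    ring
  · exact scoreP_eq_zero_of_lt_two hn _ _ _

lemma logLikelihood_le_known {a : ℝ} (ha : 0 < a) {y : Sample n} (hy : ∀ k, 0 < power y k) (p : ℝ) :
    logLikelihood y a p ≤ logLikelihood y a (expKnownScale n a y) := by
  have h := logLikelihood_sub_le y ha ha p (expKnownScale n a y)
  rw [scoreP_expKnownScale ha hy] at h
  linarith

lemma logLikelihood_le_joint {y : Sample n} (hy : ∀ k, 0 < power y k) {a : ℝ} (ha : 0 < a) (p : ℝ) :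
    logLikelihood y a p ≤ logLikelihood y (scaleOf n (expJoint n y) y) (expJoint n y) := by
  have h := logLikelihood_sub_le y ha (scaleOf_pos y (expJoint n y)) p (expJoint n y)
  rw [scoreP_joint hy, scoreA_scaleOf hy] at h
  linarith

end Estimators

/-! ### Sums of logarithms -/

lemma tendsto_log_natCast_atTop : Tendsto (fun n : ℕ => Real.log n) atTop atTop :=
  Real.tendsto_log_atTop.comp tendsto_natCast_atTop_atTop

lemma eventually_one_le_log : ∀ᶠ n : ℕ in atTop, 2 ≤ n ∧ 1 ≤ Real.log n :=
  (eventually_ge_atTop 2).and (tendsto_log_natCast_atTop.eventually_ge_atTop 1)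

lemma tendsto_log_pow_div_sqrt (m : ℕ) :
    Tendsto (fun n : ℕ => Real.log n ^ m / √n) atTop (𝓝 0) := by
  have h := (isLittleO_log_rpow_rpow_atTop (m : ℝ)
    (show (0 : ℝ) < 1 / 2 by norm_num)).tendsto_div_nhds_zero
  refine (h.comp tendsto_natCast_atTop_atTop).congr fun n => ?_
  simp [Real.sqrt_eq_rpow]

/-- The sum `∑ k ≤ n, (log n - log k) * z k`, the error made when `log k` is replaced by `log n`
in `∑ k ≤ n, log k * z k`. -/
noncomputable def logGapSum (z : ℕ → ℝ) (n : ℕ) : ℝ :=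
  ∑ k ∈ Finset.Icc 1 n, (Real.log n - Real.log k) * z k

/-- Summation by parts. -/
lemma logGapSum_eq (z : ℕ → ℝ) (n : ℕ) : logGapSum z n =
    ∑ j ∈ Finset.range n, (Real.log (j + 1 : ℕ) - Real.log j) * ∑ k ∈ Finset.Icc 1 j, z k := by
  induction n with
  | zero => simp [logGapSum]
  | succ n ih =>
    rw [Finset.sum_range_succ, ← ih, logGapSum, logGapSum, Finset.sum_Icc_succ_top (by omega),
      Finset.mul_sum, ← Finset.sum_add_distrib, sub_self, zero_mul, add_zero]
    exact Finset.sum_congr rfl fun k _ => by ring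

/-- Averages weighted by `log n - log k` have the same limit as plain averages. -/
lemma tendsto_logGapSum_div {z : ℕ → ℝ}
    (hz : Tendsto (fun n : ℕ => (∑ k ∈ Finset.Icc 1 n, z k) / n) atTop (𝓝 1)) :
    Tendsto (fun n : ℕ => logGapSum z n / n) atTop (𝓝 1) := by
  have h1 : Tendsto (fun j : ℕ => (j : ℝ) * Real.log (1 + 1 / (j : ℝ))) atTop (𝓝 1) :=
    (Real.tendsto_mul_log_one_add_div_atTop 1).comp tendsto_natCast_atTop_atTop
  have h2 : Tendsto (fun j : ℕ => (Real.log (j + 1 : ℕ) - Real.log j) *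
      ∑ k ∈ Finset.Icc 1 j, z k) atTop (𝓝 1) := by
    have h3 := h1.mul hz
    rw [one_mul] at h3
    refine h3.congr' ?_
    filter_upwards [eventually_gt_atTop 0] with j hj
    have hj' : (0 : ℝ) < j := by exact_mod_cast hj
    rw [← Real.log_div (by positivity) hj'.ne', show ((j + 1 : ℕ) : ℝ) / j = 1 + 1 / j by
      push_cast; field_simp]
    field_simp
  refine h2.cesaro.congr fun n => ?_
  rw [logGapSum_eq, div_eq_inv_mul]

lemma tendsto_sum_one_div :
    Tendsto (fun n : ℕ => (∑ _k ∈ Finset.Icc 1 n, (1 : ℝ)) / n) atTop (𝓝 1) := by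
  refine tendsto_const_nhds.congr' ?_
  filter_upwards [eventually_gt_atTop 0] with n hn
  have : (0 : ℝ) < n := by exact_mod_cast hn
  simp [this.ne']

lemma sum_log_mul (z : ℕ → ℝ) (n : ℕ) : ∑ k ∈ Finset.Icc 1 n, Real.log k * z k =
    Real.log n * ∑ k ∈ Finset.Icc 1 n, z k - logGapSum z n := by
  rw [logGapSum, Finset.mul_sum, ← Finset.sum_sub_distrib]
  exact Finset.sum_congr rfl fun k _ => by ring

lemma logGapSum_one (n : ℕ) : logGapSum (fun _ => 1) n = n * Real.log n - sumLog n := by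
  simp [logGapSum, sumLog, Finset.sum_sub_distrib]

/-- A form of Stirling's formula. -/
lemma tendsto_log_sub_mean_log :
    Tendsto (fun n : ℕ => Real.log n - sumLog n / n) atTop (𝓝 1) := by
  refine (tendsto_logGapSum_div tendsto_sum_one_div).congr' ?_
  filter_upwards [eventually_gt_atTop 0] with n hn
  have : (0 : ℝ) < n := by exact_mod_cast hn
  rw [logGapSum_one]
  field_simp

lemma log_le_log_of_mem {n k : ℕ} (hk : k ∈ Finset.Icc 1 n) :
    0 ≤ Real.log k ∧ Real.log k ≤ Real.log n := by
  rw [Finset.mem_Icc] at hk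
  exact ⟨Real.log_natCast_nonneg k,
    Real.log_le_log (by exact_mod_cast hk.1) (by exact_mod_cast hk.2)⟩

lemma sum_log_sq_mul_le {z : ℕ → ℝ} (hz : ∀ k, 0 ≤ z k) (n : ℕ) :
    ∑ k ∈ Finset.Icc 1 n, Real.log k ^ 2 * z k ≤
      Real.log n ^ 2 * ∑ k ∈ Finset.Icc 1 n, z k := by
  rw [Finset.mul_sum]
  refine Finset.sum_le_sum fun k hk => mul_le_mul_of_nonneg_right ?_ (hz k)
  have := log_le_log_of_mem hk
  nlinarith

lemma le_sum_log_sq_mul {z : ℕ → ℝ} (hz : ∀ k, 0 ≤ z k) (n : ℕ) :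
    Real.log n ^ 2 * ∑ k ∈ Finset.Icc 1 n, z k - 2 * Real.log n * logGapSum z n ≤
      ∑ k ∈ Finset.Icc 1 n, Real.log k ^ 2 * z k := by
  rw [logGapSum, Finset.mul_sum, Finset.mul_sum, ← Finset.sum_sub_distrib]
  refine Finset.sum_le_sum fun k hk => ?_
  have := log_le_log_of_mem hk
  have h : Real.log n ^ 2 - 2 * Real.log n * (Real.log n - Real.log k) ≤ Real.log k ^ 2 := by
    nlinarith [sq_nonneg (Real.log n - Real.log k)]
  have := mul_le_mul_of_nonneg_right h (hz k)
  linarith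

lemma sumLogSq_eq (n : ℕ) :
    sumLogSq n = ∑ k ∈ Finset.Icc 1 n, Real.log k ^ 2 * (fun _ => (1 : ℝ)) k := by
  simp [sumLogSq]

lemma sumLogSq_le (n : ℕ) : sumLogSq n ≤ n * Real.log n ^ 2 := by
  have h := sum_log_sq_mul_le (z := fun _ => 1) (fun _ => zero_le_one) n
  rw [← sumLogSq_eq] at h
  simpa [mul_comm] using h

lemma sumLogSq_pos {n : ℕ} (hn : 2 ≤ n) : 0 < sumLogSq n :=
  Finset.sum_pos' (fun k _ => sq_nonneg _)
    ⟨2, by simp [hn], by have := Real.log_pos (show (1 : ℝ) < 2 by norm_num); positivity⟩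

lemma sum_inv_sqrt_le (n : ℕ) : ∑ k ∈ Finset.Icc 1 n, 1 / √(k : ℝ) ≤ 2 * √n := by
  induction n with
  | zero => simp
  | succ n ih =>
    rw [Finset.sum_Icc_succ_top (by omega)]
    have h1 := Real.sq_sqrt (Nat.cast_nonneg (α := ℝ) n)
    have h2 := Real.sq_sqrt (Nat.cast_nonneg (α := ℝ) (n + 1))
    have h3 : 0 < √((n + 1 : ℕ) : ℝ) := by positivity
    have h4 := Real.sqrt_nonneg (n : ℝ)
    have h5 : 1 / √((n + 1 : ℕ) : ℝ) ≤ 2 * √((n + 1 : ℕ) : ℝ) - 2 * √n := by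
      rw [div_le_iff₀ h3]
      push_cast at h2 ⊢
      push_cast at h3
      nlinarith [sq_nonneg (√((n : ℝ) + 1) - √n)]
    linarith

/-- Any power `x ^ s` with `s < 1` on the right would serve to sum `log² (n / k)` over `k ≤ n`. -/
lemma log_sq_le_sqrt {x : ℝ} (hx : 1 ≤ x) : Real.log x ^ 2 ≤ 16 * √x := by
  have h0 : 0 ≤ Real.log x := Real.log_nonneg hx
  have h1 : Real.log x = 4 * Real.log √√x := by
    rw [Real.log_sqrt (by positivity), Real.log_sqrt (by positivity)]; ring
  have h2 := Real.log_le_self (Real.sqrt_nonneg √x)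
  have h3 := Real.sq_sqrt (Real.sqrt_nonneg x)
  nlinarith

lemma sum_log_gap_sq_le (n : ℕ) :
    ∑ k ∈ Finset.Icc 1 n, (Real.log n - Real.log k) ^ 2 ≤ 32 * n := by
  have h : ∀ k ∈ Finset.Icc 1 n,
      (Real.log n - Real.log k) ^ 2 ≤ 16 * √n * (1 / √(k : ℝ)) := by
    intro k hk
    rw [Finset.mem_Icc] at hk
    have hk0 : (0 : ℝ) < k := by exact_mod_cast hk.1
    have hkn : (k : ℝ) ≤ n := by exact_mod_cast hk.2
    rw [← Real.log_div (by linarith) hk0.ne']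
    refine (log_sq_le_sqrt ((one_le_div hk0).2 hkn)).trans (le_of_eq ?_)
    rw [Real.sqrt_div (by positivity)]
    ring
  refine (Finset.sum_le_sum h).trans ?_
  rw [← Finset.mul_sum]
  have h1 := sum_inv_sqrt_le n
  have h2 := Real.mul_self_sqrt (Nat.cast_nonneg (α := ℝ) n)
  have h3 := Real.sqrt_nonneg (n : ℝ)
  nlinarith

/-- The empirical variance of `log 1, …, log n` stays bounded. -/
lemma sumLogSq_sub_le {n : ℕ} (hn : 1 ≤ n) : sumLogSq n - sumLog n ^ 2 / n ≤ 32 * n := by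
  have hn0 : (0 : ℝ) < n := by exact_mod_cast hn
  have h : ∑ k ∈ Finset.Icc 1 n, (Real.log n - Real.log k) ^ 2 =
      n * Real.log n ^ 2 - 2 * Real.log n * sumLog n + sumLogSq n := by
    simp only [sub_sq, Finset.sum_add_distrib, Finset.sum_sub_distrib, sumLog, sumLogSq,
      Finset.mul_sum]
    simp
  have h2 := sum_log_gap_sq_le n
  have h3 : 0 ≤ (n * Real.log n - sumLog n) ^ 2 / n := by positivity
  have h4 : (n * Real.log n - sumLog n) ^ 2 / n =
      n * Real.log n ^ 2 - 2 * Real.log n * sumLog n + sumLog n ^ 2 / n := by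
    field_simp
    ring
  linarith

lemma sumLog_sq_le (n : ℕ) : sumLog n ^ 2 ≤ n * sumLogSq n := by
  have := sq_sum_le_card_mul_sum_sq (s := Finset.Icc 1 n) (f := fun k : ℕ => Real.log k)
  simpa [sumLog, sumLogSq] using this

lemma tendsto_sumLog_div : Tendsto (fun n : ℕ => sumLog n / (n * Real.log n)) atTop (𝓝 1) := by
  have h := tendsto_log_sub_mean_log.mul tendsto_log_natCast_atTop.inv_tendsto_atTop
  have h2 := h.const_sub 1
  simp only [mul_zero, sub_zero] at h2
  refine h2.congr' ?_
  filter_upwards [eventually_one_le_log] with n hn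
  have : (0 : ℝ) < n := by have := hn.1; positivity
  have : 0 < Real.log n := by linarith [hn.2]
  simp only [Pi.inv_apply]
  field_simp
  ring

/-! ### Deterministic bounds on the roots -/

lemma natCast_rpow_two_mul {k : ℕ} (hk : 1 ≤ k) (q : ℝ) :
    (k : ℝ) ^ (2 * q) = Real.exp (2 * q * Real.log k) := by
  rw [Real.rpow_def_of_pos (by exact_mod_cast hk)]
  congr 1; ring

/-- The normalized sum `(∑ k ≤ n, (z k - 1)) / √n`. -/
noncomputable def fluct (z : ℕ → ℝ) (n : ℕ) : ℝ := (∑ k ∈ Finset.Icc 1 n, (z k - 1)) / √n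

/-- The remainder `∑ k ≤ n, (log n - log k) * (z k - 1)`, normalized by `√n * log n`. It tends to
`0` in probability, because the squares of the weights `log n - log k` add up to `O(n)` only. -/
noncomputable def gapFluct (z : ℕ → ℝ) (n : ℕ) : ℝ :=
  (∑ k ∈ Finset.Icc 1 n, (Real.log n - Real.log k) * (z k - 1)) / (√n * Real.log n)

lemma sum_sub_one (z : ℕ → ℝ) (n : ℕ) :
    ∑ k ∈ Finset.Icc 1 n, (z k - 1) = √n * fluct z n := by
  rcases Nat.eq_zero_or_pos n with h | h
  · simp [h]
  · have : 0 < √(n : ℝ) := by positivity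
    rw [fluct]; field_simp

lemma sum_gap_sub_one (z : ℕ → ℝ) {n : ℕ} (hn : 2 ≤ n) :
    logGapSum (fun k => z k - 1) n = √n * Real.log n * gapFluct z n := by
  have : 0 < √(n : ℝ) := by positivity
  have : 0 < Real.log n := Real.log_pos (by exact_mod_cast hn)
  rw [gapFluct, logGapSum]; field_simp

lemma sum_log_mul_sub_one (z : ℕ → ℝ) {n : ℕ} (hn : 2 ≤ n) :
    ∑ k ∈ Finset.Icc 1 n, Real.log k * (z k - 1) =
      √n * Real.log n * (fluct z n - gapFluct z n) := by
  rw [sum_log_mul, sum_sub_one, sum_gap_sub_one z hn]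
  ring

section KnownScale

/-- The bound `|exp (2 q x) - 1| ≥ 2 |q| x / (1 + 2 |q| x)` holds for either sign of `q`. -/
lemma abs_mul_le_exp_sub_one {q x ℓ : ℝ} (hx : 0 ≤ x) (hxl : x ≤ ℓ) :
    2 * |q| * x ≤ (1 + 2 * |q| * ℓ) * (SignType.sign q * (Real.exp (2 * q * x) - 1)) := by
  have hl : 0 ≤ ℓ := hx.trans hxl
  rcases lt_trichotomy q 0 with hq | hq | hq
  · rw [abs_of_neg hq, sign_neg hq]
    have hu : 0 ≤ 2 * -q * x := by have := neg_pos.2 hq; positivity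
    have h1 : Real.exp (2 * q * x) * (1 + 2 * -q * x) ≤ 1 := by
      have h2 := Real.add_one_le_exp (2 * -q * x)
      have h3 : Real.exp (2 * q * x) * Real.exp (2 * -q * x) = 1 := by
        rw [← Real.exp_add]; simp
      have := mul_le_mul_of_nonneg_left h2 (Real.exp_pos (2 * q * x)).le
      linarith
    have h4 : Real.exp (2 * q * x) ≤ 1 := Real.exp_le_one_iff.2 (by linarith)
    have h5 : 2 * -q * x ≤ 2 * -q * ℓ := by
      have := neg_pos.2 hq
      gcongr
    simp only [SignType.coe_neg, SignType.coe_one]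
    nlinarith
  · simp [hq]
  · rw [abs_of_pos hq, sign_pos hq]
    have h1 := Real.add_one_le_exp (2 * q * x)
    have h2 : 0 ≤ 2 * q * ℓ := by positivity
    have h3 : 0 ≤ 2 * q * x := by positivity
    simp only [SignType.coe_one]
    nlinarith

variable {z : ℕ → ℝ} {n : ℕ} {q : ℝ}

lemma sum_log_mul_exp_sub_one
    (hq : ∑ k ∈ Finset.Icc 1 n, Real.log k * ((k : ℝ) ^ (2 * q) * z k - 1) = 0) :
    ∑ k ∈ Finset.Icc 1 n, Real.log k * ((Real.exp (2 * q * Real.log k) - 1) * z k) =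
      -∑ k ∈ Finset.Icc 1 n, Real.log k * (z k - 1) := by
  rw [eq_neg_iff_add_eq_zero, ← hq, ← Finset.sum_add_distrib]
  refine Finset.sum_congr rfl fun k hk => ?_
  rw [natCast_rpow_two_mul (Finset.mem_Icc.1 hk).1]
  ring

/-- A crude bound on the zero of the score, valid without knowing beforehand that it is small. -/
lemma abs_mul_sum_le_of_root (hz : ∀ k, 0 ≤ z k)
    (hq : ∑ k ∈ Finset.Icc 1 n, Real.log k * ((k : ℝ) ^ (2 * q) * z k - 1) = 0) :
    2 * |q| * ∑ k ∈ Finset.Icc 1 n, Real.log k ^ 2 * z k ≤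
      (1 + 2 * |q| * Real.log n) * |∑ k ∈ Finset.Icc 1 n, Real.log k * (z k - 1)| := by
  have h1 : 2 * |q| * ∑ k ∈ Finset.Icc 1 n, Real.log k ^ 2 * z k ≤
      (1 + 2 * |q| * Real.log n) * (SignType.sign q *
        ∑ k ∈ Finset.Icc 1 n, Real.log k * ((Real.exp (2 * q * Real.log k) - 1) * z k)) := by
    simp only [Finset.mul_sum]
    refine Finset.sum_le_sum fun k hk => ?_
    have hl := log_le_log_of_mem hk
    have h := mul_le_mul_of_nonneg_right (abs_mul_le_exp_sub_one (q := q) hl.1 hl.2)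
      (mul_nonneg hl.1 (hz k))
    linarith
  rw [sum_log_mul_exp_sub_one hq] at h1
  refine h1.trans (mul_le_mul_of_nonneg_left ?_ ?_)
  · rcases lt_trichotomy q 0 with hq | hq | hq
    · simpa [sign_neg hq] using le_abs_self _
    · simp [hq]
    · simpa [sign_pos hq] using neg_le_abs _
  · have := Real.log_natCast_nonneg n
    positivity

lemma abs_exp_sub_le {q x ℓ : ℝ} (hx : 0 ≤ x) (hxl : x ≤ ℓ) (h : 2 * |q| * ℓ ≤ 1) :
    |Real.exp (2 * q * x) - 1 - 2 * q * x| ≤ 2 * |q| * ℓ * (2 * |q| * x) := by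
  have h0 : |2 * q * x| = 2 * |q| * x := by rw [abs_mul, abs_mul, abs_two, abs_of_nonneg hx]
  have h1 : 2 * |q| * x ≤ 2 * |q| * ℓ := by gcongr
  refine (Real.abs_exp_sub_one_sub_id_le (by rw [h0]; linarith)).trans ?_
  rw [← sq_abs, h0, sq]
  have : 0 ≤ 2 * |q| * x := by positivity
  gcongr

/-- Linearization of the score at the true parameter. -/
lemma abs_sum_add_mul_le_of_root (hz : ∀ k, 0 ≤ z k)
    (hq : ∑ k ∈ Finset.Icc 1 n, Real.log k * ((k : ℝ) ^ (2 * q) * z k - 1) = 0)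
    (hs : 2 * |q| * Real.log n ≤ 1) :
    |∑ k ∈ Finset.Icc 1 n, Real.log k * (z k - 1) +
        2 * q * ∑ k ∈ Finset.Icc 1 n, Real.log k ^ 2 * z k| ≤
      2 * |q| * Real.log n * (2 * |q| * ∑ k ∈ Finset.Icc 1 n, Real.log k ^ 2 * z k) := by
  rw [← neg_eq_iff_eq_neg.2 (sum_log_mul_exp_sub_one hq), neg_add_eq_sub, abs_sub_comm]
  simp only [Finset.mul_sum]
  rw [← Finset.sum_sub_distrib]
  refine (Finset.abs_sum_le_sum_abs _ _).trans (Finset.sum_le_sum fun k hk => ?_)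
  have hl := log_le_log_of_mem hk
  have h := mul_le_mul_of_nonneg_right (abs_exp_sub_le (q := q) hl.1 hl.2 hs)
    (mul_nonneg hl.1 (hz k))
  rw [← abs_of_nonneg (mul_nonneg hl.1 (hz k)), ← abs_mul,
    abs_of_nonneg (mul_nonneg hl.1 (hz k))] at h
  calc _ = |(Real.exp (2 * q * Real.log k) - 1 - 2 * q * Real.log k) * (Real.log k * z k)| := by
        congr 1; ring
    _ ≤ _ := h
    _ = _ := by ring

end KnownScale

section JointEstimation

variable {z : ℕ → ℝ} {n : ℕ} {q : ℝ}

lemma le_mul_exp_of_nonneg (c : ℝ) {q : ℝ} (hq : 0 ≤ q) :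
    c + 2 * q * max c 0 ^ 2 ≤ c * Real.exp (2 * q * c) := by
  rcases le_total 0 c with hc | hc
  · rw [max_eq_left hc]
    nlinarith [Real.add_one_le_exp (2 * q * c)]
  · rw [max_eq_right hc]
    have : Real.exp (2 * q * c) ≤ 1 := Real.exp_le_one_iff.2 (by nlinarith)
    nlinarith

lemma mul_exp_le_of_nonpos (c : ℝ) {q : ℝ} (hq : q ≤ 0) :
    c * Real.exp (2 * q * c) ≤ c + 2 * q * max (-c) 0 ^ 2 := by
  have := le_mul_exp_of_nonneg (-c) (neg_nonneg.2 hq)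
  rw [show 2 * -q * -c = 2 * q * c by ring] at this
  linarith

/-- Only the frequencies on one side of the geometric mean are used, according to the sign of `q`:
there the exponential bound is linear in `q`, however large `q` is. -/
lemma abs_mul_le_of_joint_root (hz : ∀ k, 0 ≤ z k) {m Q : ℝ}
    (hq : ∑ k ∈ Finset.Icc 1 n, (Real.log k - m) * ((k : ℝ) ^ (2 * q) * z k) = 0)
    (hQ : Q ≤ ∑ k ∈ Finset.Icc 1 n, max (Real.log k - m) 0 ^ 2 * z k)
    (hQ' : Q ≤ ∑ k ∈ Finset.Icc 1 n, max (-(Real.log k - m)) 0 ^ 2 * z k) :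
    2 * |q| * Q ≤ |∑ k ∈ Finset.Icc 1 n, (Real.log k - m) * z k| := by
  have h0 : ∑ k ∈ Finset.Icc 1 n,
      (Real.log k - m) * Real.exp (2 * q * (Real.log k - m)) * z k = 0 := by
    have : Real.exp (-(2 * q * m)) *
        ∑ k ∈ Finset.Icc 1 n, (Real.log k - m) * ((k : ℝ) ^ (2 * q) * z k) = 0 := by
      rw [hq, mul_zero]
    rw [← this, Finset.mul_sum]
    refine Finset.sum_congr rfl fun k hk => ?_
    rw [natCast_rpow_two_mul (Finset.mem_Icc.1 hk).1,
      show 2 * q * (Real.log k - m) = -(2 * q * m) + 2 * q * Real.log k by ring, Real.exp_add]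
    ring
  rcases le_total 0 q with h | h
  · have h1 := Finset.sum_le_sum fun k (_ : k ∈ Finset.Icc 1 n) =>
      mul_le_mul_of_nonneg_right (le_mul_exp_of_nonneg (Real.log k - m) h) (hz k)
    simp only [add_mul, Finset.sum_add_distrib, mul_assoc (2 * q), ← Finset.mul_sum] at h1
    rw [h0] at h1
    rw [abs_of_nonneg h]
    have h2 := mul_le_mul_of_nonneg_left hQ (show 0 ≤ 2 * q by linarith)
    have := neg_le_abs (∑ k ∈ Finset.Icc 1 n, (Real.log k - m) * z k)
    linarith
  · have h1 := Finset.sum_le_sum fun k (_ : k ∈ Finset.Icc 1 n) =>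
      mul_le_mul_of_nonneg_right (mul_exp_le_of_nonpos (Real.log k - m) h) (hz k)
    simp only [add_mul, Finset.sum_add_distrib, mul_assoc (2 * q), ← Finset.mul_sum] at h1
    rw [h0] at h1
    rw [abs_of_nonpos h]
    have h2 := mul_le_mul_of_nonneg_left hQ' (show 0 ≤ 2 * -q by linarith)
    have := le_abs_self (∑ k ∈ Finset.Icc 1 n, (Real.log k - m) * z k)
    linarith

lemma tendsto_natDiv_atTop {m : ℕ} (hm : 0 < m) : Tendsto (fun n : ℕ => n / m) atTop atTop :=
  Nat.tendsto_div_const_atTop hm.ne'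

/-- A positive proportion of the frequencies lies well above, and a positive proportion well below,
the geometric mean of `1, …, n`. -/
lemma eventually_le_sum_max (hz : ∀ k, 0 ≤ z k)
    (hlim : Tendsto (fun n : ℕ => (∑ k ∈ Finset.Icc 1 n, z k) / n) atTop (𝓝 1)) :
    ∀ᶠ n : ℕ in atTop,
      (n : ℝ) / 128 ≤ ∑ k ∈ Finset.Icc 1 n, max (Real.log k - sumLog n / n) 0 ^ 2 * z k ∧
      (n : ℝ) / 128 ≤ ∑ k ∈ Finset.Icc 1 n, max (-(Real.log k - sumLog n / n)) 0 ^ 2 * z k := by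
  have hS : ∀ᶠ n : ℕ in atTop, 1 ≤ n ∧ 7 / 8 * (n : ℝ) ≤ ∑ k ∈ Finset.Icc 1 n, z k ∧
      ∑ k ∈ Finset.Icc 1 n, z k ≤ 9 / 8 * (n : ℝ) := by
    filter_upwards [hlim.eventually_const_le (show (7 / 8 : ℝ) < 1 by norm_num),
      hlim.eventually_le_const (show (1 : ℝ) < 9 / 8 by norm_num), eventually_ge_atTop 1]
      with n h1 h2 hn
    have hn0 : (0 : ℝ) < n := by exact_mod_cast hn
    exact ⟨hn, (le_div_iff₀ hn0).1 h1, (div_le_iff₀ hn0).1 h2⟩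
  have hl2 := Real.log_two_lt_d9
  have hl2' := Real.log_two_gt_d9
  have hl4 : Real.log 4 = 2 * Real.log 2 := by
    rw [show (4 : ℝ) = 2 ^ 2 by norm_num, Real.log_pow]; norm_num
  filter_upwards [hS, (tendsto_natDiv_atTop two_pos).eventually hS,
    (tendsto_natDiv_atTop four_pos).eventually hS,
    tendsto_log_sub_mean_log.eventually_const_le (show (0.95 : ℝ) < 1 by norm_num),
    tendsto_log_sub_mean_log.eventually_le_const (show (1 : ℝ) < 1.05 by norm_num),
    eventually_ge_atTop 16] with n h1 h2 h4 hm hm' hn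
  have hn0 : (0 : ℝ) < n := by have : 0 < n := by omega
                               exact_mod_cast this
  constructor
  -- the geometric mean is close to `n / e`, and `e / 2` and `4 / e` both exceed `exp (1 / 4)`:
  -- the frequencies in `(n / 2, n]` and in `[1, n / 4]` are used
  · have hsub : Finset.Icc 1 (n / 2) ⊆ Finset.Icc 1 n :=
      Finset.Icc_subset_Icc_right (Nat.div_le_self _ _)
    have hd := Finset.sum_sdiff (f := z) hsub
    have hle : ∑ k ∈ Finset.Icc 1 n \ Finset.Icc 1 (n / 2), 1 / 16 * z k ≤
        ∑ k ∈ Finset.Icc 1 n, max (Real.log k - sumLog n / n) 0 ^ 2 * z k := by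
      refine (Finset.sum_le_sum fun k hk => mul_le_mul_of_nonneg_right ?_ (hz k)).trans
        (Finset.sum_le_sum_of_subset_of_nonneg Finset.sdiff_subset
          fun k _ _ => mul_nonneg (sq_nonneg _) (hz k))
      simp only [Finset.mem_sdiff, Finset.mem_Icc] at hk
      have hk2 : n ≤ k * 2 := by omega
      have hk0 : (0 : ℝ) < k := by exact_mod_cast hk.1.1
      have h5 : Real.log n ≤ Real.log k + Real.log 2 := by
        rw [← Real.log_mul hk0.ne' two_ne_zero]
        exact Real.log_le_log hn0 (by exact_mod_cast hk2)
      have h6 : 1 / 4 ≤ max (Real.log k - sumLog n / n) 0 := le_max_of_le_left (by linarith)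
      nlinarith
    rw [← Finset.mul_sum] at hle
    have h7 : ((n / 2 : ℕ) : ℝ) ≤ n / 2 := by exact_mod_cast Nat.cast_div_le (α := ℝ)
    linarith [h1.2.1, h2.2.2]
  · have hle : ∑ k ∈ Finset.Icc 1 (n / 4), 1 / 16 * z k ≤
        ∑ k ∈ Finset.Icc 1 n, max (-(Real.log k - sumLog n / n)) 0 ^ 2 * z k := by
      refine (Finset.sum_le_sum fun k hk => mul_le_mul_of_nonneg_right ?_ (hz k)).trans
        (Finset.sum_le_sum_of_subset_of_nonneg
          (Finset.Icc_subset_Icc_right (Nat.div_le_self _ _))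
          fun k _ _ => mul_nonneg (sq_nonneg _) (hz k))
      rw [Finset.mem_Icc] at hk
      have hk2 : k * 4 ≤ n := by omega
      have hk0 : (0 : ℝ) < k := by exact_mod_cast hk.1
      have h5 : Real.log k + Real.log 4 ≤ Real.log n := by
        rw [← Real.log_mul hk0.ne' four_ne_zero]
        exact Real.log_le_log (by positivity) (by exact_mod_cast hk2)
      have h6 : 1 / 4 ≤ max (-(Real.log k - sumLog n / n)) 0 := le_max_of_le_left (by linarith)
      nlinarith
    rw [← Finset.mul_sum] at hle
    have h7 : (n : ℝ) ≤ 4 * ((n / 4 : ℕ) : ℝ) + 3 := by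
      have : n ≤ 4 * (n / 4) + 3 := by omega
      exact_mod_cast this
    have h8 : (16 : ℝ) ≤ n := by exact_mod_cast hn
    linarith [h4.2.1]

end JointEstimation

/-! ### Consistency -/

section LawOfLargeNumbers

variable {z : ℕ → ℝ}

lemma sum_sub_one_eq (z : ℕ → ℝ) (n : ℕ) :
    ∑ k ∈ Finset.Icc 1 n, (z k - 1) = ∑ k ∈ Finset.Icc 1 n, z k - n := by
  simp [Finset.sum_sub_distrib]

lemma logGapSum_sub_one (z : ℕ → ℝ) (n : ℕ) :
    logGapSum (fun k => z k - 1) n = logGapSum z n - logGapSum (fun _ => 1) n := by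
  simp only [logGapSum, ← Finset.sum_sub_distrib]
  exact Finset.sum_congr rfl fun k _ => by ring

lemma tendsto_sum_log_mul_sub_one_div
    (hlim : Tendsto (fun n : ℕ => (∑ k ∈ Finset.Icc 1 n, z k) / n) atTop (𝓝 1)) :
    Tendsto (fun n : ℕ => (∑ k ∈ Finset.Icc 1 n, Real.log k * (z k - 1)) / (n * Real.log n))
      atTop (𝓝 0) := by
  have h := (hlim.sub_const 1).sub (((tendsto_logGapSum_div hlim).sub
    (tendsto_logGapSum_div tendsto_sum_one_div)).mul tendsto_log_natCast_atTop.inv_tendsto_atTop)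
  simp only [sub_self, zero_mul] at h
  refine h.congr' ?_
  filter_upwards [eventually_one_le_log] with n hn
  have : (0 : ℝ) < n := by have := hn.1; positivity
  have : 0 < Real.log n := by linarith [hn.2]
  rw [sum_log_mul, sum_sub_one_eq, logGapSum_sub_one]
  simp only [Pi.inv_apply]
  field_simp

lemma sum_log_sq_div_mem (hz : ∀ k, 0 ≤ z k) {n : ℕ} (hn : 2 ≤ n ∧ 1 ≤ Real.log n) :
    (∑ k ∈ Finset.Icc 1 n, Real.log k ^ 2 * z k) / (n * Real.log n ^ 2) ≤
        (∑ k ∈ Finset.Icc 1 n, z k) / n ∧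
      (∑ k ∈ Finset.Icc 1 n, z k) / n - 2 * (logGapSum z n / n) * (Real.log n)⁻¹ ≤
        (∑ k ∈ Finset.Icc 1 n, Real.log k ^ 2 * z k) / (n * Real.log n ^ 2) := by
  have h0 : (0 : ℝ) < n := by have := hn.1; positivity
  have h1 : 0 < Real.log n := by linarith [hn.2]
  constructor
  · rw [div_le_iff₀ (by positivity)]
    refine (sum_log_sq_mul_le hz n).trans (le_of_eq ?_)
    field_simp
  · rw [le_div_iff₀ (by positivity)]
    refine le_trans (le_of_eq ?_) (le_sum_log_sq_mul hz n)
    field_simp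

lemma tendsto_sum_log_sq_div (hz : ∀ k, 0 ≤ z k)
    (hlim : Tendsto (fun n : ℕ => (∑ k ∈ Finset.Icc 1 n, z k) / n) atTop (𝓝 1)) :
    Tendsto (fun n : ℕ => (∑ k ∈ Finset.Icc 1 n, Real.log k ^ 2 * z k) / (n * Real.log n ^ 2))
      atTop (𝓝 1) := by
  have h := hlim.sub (((tendsto_logGapSum_div hlim).const_mul 2).mul
    tendsto_log_natCast_atTop.inv_tendsto_atTop)
  simp only [mul_zero, sub_zero] at h
  refine tendsto_of_tendsto_of_tendsto_of_le_of_le' h hlim ?_ ?_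
  · filter_upwards [eventually_one_le_log] with n hn using (sum_log_sq_div_mem hz hn).2
  · filter_upwards [eventually_one_le_log] with n hn using (sum_log_sq_div_mem hz hn).1

lemma tendsto_sumLogSq_div :
    Tendsto (fun n : ℕ => sumLogSq n / (n * Real.log n ^ 2)) atTop (𝓝 1) := by
  simp only [sumLogSq_eq]
  exact tendsto_sum_log_sq_div (fun _ => zero_le_one) tendsto_sum_one_div

lemma eventually_abs_mul_log_le (hz : ∀ k, 0 ≤ z k)
    (hlim : Tendsto (fun n : ℕ => (∑ k ∈ Finset.Icc 1 n, z k) / n) atTop (𝓝 1)) {q : ℕ → ℝ}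
    (hq : ∀ᶠ n : ℕ in atTop,
      ∑ k ∈ Finset.Icc 1 n, Real.log k * ((k : ℝ) ^ (2 * q n) * z k - 1) = 0) :
    ∀ᶠ n : ℕ in atTop, 2 * |q n| * Real.log n ≤
      2 * |(∑ k ∈ Finset.Icc 1 n, Real.log k * (z k - 1)) / (n * Real.log n)| := by
  have ha := (tendsto_sum_log_mul_sub_one_div hlim).abs
  rw [abs_zero] at ha
  filter_upwards [hq, eventually_one_le_log,
    ha.eventually_le_const (show (0 : ℝ) < 1 / 4 by norm_num),
    (tendsto_sum_log_sq_div hz hlim).eventually_const_le (show (3 / 4 : ℝ) < 1 by norm_num)]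
    with n hqn hn ha hb
  have h0 : (0 : ℝ) < n := by have := hn.1; positivity
  have h1 : 0 < Real.log n := by linarith [hn.2]
  have h2 := abs_mul_sum_le_of_root hz hqn
  rw [abs_div, abs_of_pos (mul_pos h0 h1)] at ha ⊢
  set A := |∑ k ∈ Finset.Icc 1 n, Real.log k * (z k - 1)|
  set B := ∑ k ∈ Finset.Icc 1 n, Real.log k ^ 2 * z k
  set b := B / (n * Real.log n ^ 2) with hbdef
  set a := A / (n * Real.log n) with hadef
  have hB : B = b * (n * Real.log n ^ 2) := by rw [hbdef]; field_simp
  have hA : A = a * (n * Real.log n) := by rw [hadef]; field_simp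
  rw [hA, hB] at h2
  have h3 : 2 * |q n| * Real.log n * b ≤ (1 + 2 * |q n| * Real.log n) * a := by
    refine le_of_mul_le_mul_right ?_ (mul_pos h0 h1)
    linarith
  have h4 : 0 ≤ 2 * |q n| * Real.log n := by positivity
  nlinarith

/-- Strong consistency of the zero of the score in the case of a known scale, with a rate. -/
lemma tendsto_mul_log_of_root (hz : ∀ k, 0 ≤ z k)
    (hlim : Tendsto (fun n : ℕ => (∑ k ∈ Finset.Icc 1 n, z k) / n) atTop (𝓝 1)) {q : ℕ → ℝ}
    (hq : ∀ᶠ n : ℕ in atTop,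
      ∑ k ∈ Finset.Icc 1 n, Real.log k * ((k : ℝ) ^ (2 * q n) * z k - 1) = 0) :
    Tendsto (fun n : ℕ => 2 * |q n| * Real.log n) atTop (𝓝 0) := by
  have ha := ((tendsto_sum_log_mul_sub_one_div hlim).abs).const_mul 2
  rw [abs_zero, mul_zero] at ha
  refine tendsto_of_tendsto_of_tendsto_of_le_of_le' tendsto_const_nhds ha
    (Eventually.of_forall fun n => ?_) (eventually_abs_mul_log_le hz hlim hq)
  have := Real.log_natCast_nonneg n
  positivity

lemma tendsto_zero_of_root (hz : ∀ k, 0 ≤ z k)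
    (hlim : Tendsto (fun n : ℕ => (∑ k ∈ Finset.Icc 1 n, z k) / n) atTop (𝓝 1)) {q : ℕ → ℝ}
    (hq : ∀ᶠ n : ℕ in atTop,
      ∑ k ∈ Finset.Icc 1 n, Real.log k * ((k : ℝ) ^ (2 * q n) * z k - 1) = 0) :
    Tendsto q atTop (𝓝 0) := by
  refine squeeze_zero_norm' ?_ (tendsto_mul_log_of_root hz hlim hq)
  filter_upwards [eventually_one_le_log] with n hn
  rw [Real.norm_eq_abs]
  nlinarith [abs_nonneg (q n), hn.2]

lemma sum_log_sub_mean_mul (z : ℕ → ℝ) (n : ℕ) (m : ℝ) :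
    ∑ k ∈ Finset.Icc 1 n, (Real.log k - m) * z k =
      (Real.log n - m) * ∑ k ∈ Finset.Icc 1 n, z k - logGapSum z n := by
  simp only [sub_mul, Finset.sum_sub_distrib, sum_log_mul, ← Finset.mul_sum]
  ring

lemma eventually_abs_le_of_joint_root (hz : ∀ k, 0 ≤ z k)
    (hlim : Tendsto (fun n : ℕ => (∑ k ∈ Finset.Icc 1 n, z k) / n) atTop (𝓝 1)) {q : ℕ → ℝ}
    (hq : ∀ᶠ n : ℕ in atTop, ∑ k ∈ Finset.Icc 1 n,
      (Real.log k - sumLog n / n) * ((k : ℝ) ^ (2 * q n) * z k) = 0) :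
    ∀ᶠ n : ℕ in atTop, |q n| ≤
      64 * (|∑ k ∈ Finset.Icc 1 n, (Real.log k - sumLog n / n) * z k| / n) := by
  filter_upwards [hq, eventually_le_sum_max hz hlim, eventually_gt_atTop 0] with n h1 h2 hn
  have h0 : (0 : ℝ) < n := by exact_mod_cast hn
  have h3 := abs_mul_le_of_joint_root hz h1 h2.1 h2.2
  rw [← mul_div_assoc, le_div_iff₀ h0]
  linarith

/-- Strong consistency of the joint estimator of the exponent. -/
lemma tendsto_zero_of_joint_root (hz : ∀ k, 0 ≤ z k)
    (hlim : Tendsto (fun n : ℕ => (∑ k ∈ Finset.Icc 1 n, z k) / n) atTop (𝓝 1)) {q : ℕ → ℝ}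
    (hq : ∀ᶠ n : ℕ in atTop, ∑ k ∈ Finset.Icc 1 n,
      (Real.log k - sumLog n / n) * ((k : ℝ) ^ (2 * q n) * z k) = 0) :
    Tendsto q atTop (𝓝 0) := by
  refine squeeze_zero_norm' (eventually_abs_le_of_joint_root hz hlim hq) ?_
  have h := ((tendsto_log_sub_mean_log.mul hlim).sub (tendsto_logGapSum_div hlim)).abs.const_mul 64
  simp only [mul_one, sub_self, abs_zero, mul_zero] at h
  refine h.congr fun n => ?_
  rw [sum_log_sub_mean_mul, ← mul_div_assoc, ← sub_div, abs_div, Nat.abs_cast]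

end LawOfLargeNumbers

/-! ### Second-order estimates -/

section Rates

variable {z : ℕ → ℝ} {l : Filter ℕ}

lemma tendsto_abs_add_div (hG : Tendsto (fun n => fluct z n / Real.log n) l (𝓝 0))
    (hE : Tendsto (gapFluct z) l (𝓝 0)) (hl : l ≤ atTop) :
    Tendsto (fun n : ℕ => (|fluct z n| + |gapFluct z n|) / Real.log n) l (𝓝 0) := by
  have h := hG.abs.add
    (hE.abs.mul (tendsto_log_natCast_atTop.inv_tendsto_atTop.mono_left hl))
  simp only [abs_zero, zero_mul, add_zero] at h
  refine h.congr fun n => ?_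
  rw [abs_div, abs_of_nonneg (Real.log_natCast_nonneg n)]
  simp only [Pi.inv_apply]
  ring

/-- A second-order estimate for `∑ log² k * z k`: the relative error is `O(1 / log n)`, so that it
remains negligible after multiplication by a quantity of order `o(log n)`. -/
lemma eventually_log_mul_abs_sub_one_le (hz : ∀ k, 0 ≤ z k)
    (hlim : Tendsto (fun n : ℕ => (∑ k ∈ Finset.Icc 1 n, z k) / n) atTop (𝓝 1)) (hl : l ≤ atTop)
    (hG : Tendsto (fun n => fluct z n / Real.log n) l (𝓝 0)) :
    ∀ᶠ n : ℕ in l, Real.log n * |(∑ k ∈ Finset.Icc 1 n, Real.log k ^ 2 * z k) /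
      (n * Real.log n ^ 2) - 1| ≤ 4 := by
  have h1 := (hG.mul ((tendsto_log_pow_div_sqrt 2).mono_left hl)).abs
  simp only [mul_zero, abs_zero] at h1
  filter_upwards [h1.eventually_le_const (show (0 : ℝ) < 1 by norm_num),
    hl eventually_one_le_log,
    hl ((tendsto_logGapSum_div hlim).eventually_le_const (show (1 : ℝ) < 3 / 2 by norm_num))]
    with n h1 hn hT
  have h0 : (0 : ℝ) < n := by have := hn.1; positivity
  have hlog : 0 < Real.log n := by linarith [hn.2]
  have hsq : √(n : ℝ) * √n = n := Real.mul_self_sqrt h0.le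
  have hs0 : 0 < √(n : ℝ) := by positivity
  have hM : Real.log n * ((∑ k ∈ Finset.Icc 1 n, z k) / n - 1) =
      fluct z n / Real.log n * (Real.log n ^ 2 / √n) := by
    rw [fluct, sum_sub_one_eq]
    field_simp
    rw [Real.sq_sqrt h0.le, mul_comm]
  have hmem := sum_log_sq_div_mem hz hn
  rw [← hM, abs_le] at h1
  set b := (∑ k ∈ Finset.Icc 1 n, Real.log k ^ 2 * z k) / (n * Real.log n ^ 2)
  set M := (∑ k ∈ Finset.Icc 1 n, z k) / (n : ℝ)
  have h2 := mul_le_mul_of_nonneg_left hmem.1 hlog.le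
  have h3 := mul_le_mul_of_nonneg_left hmem.2 hlog.le
  have h4 : Real.log n * (M - 2 * (logGapSum z n / n) * (Real.log n)⁻¹) =
      Real.log n * M - 2 * (logGapSum z n / n) := by field_simp
  rw [h4] at h3
  rw [show Real.log n * |b - 1| = |Real.log n * (b - 1)| by rw [abs_mul, abs_of_pos hlog], abs_le]
  constructor <;> linarith

lemma fluct_one (n : ℕ) : fluct (fun _ => 1) n = 0 := by simp [fluct]

lemma eventually_log_mul_abs_sumLogSq_sub_one_le : ∀ᶠ n : ℕ in atTop,
    Real.log n * |sumLogSq n / (n * Real.log n ^ 2) - 1| ≤ 4 := by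
  simp only [sumLogSq_eq]
  exact eventually_log_mul_abs_sub_one_le (fun _ => zero_le_one) tendsto_sum_one_div le_rfl
    (by simp [fluct_one])

/-- The algebra behind the linearization: `u` is the normalized error, `x` the normalized score,
`σ` and `b` the normalized Fisher informations, expected and observed. -/
lemma abs_sub_le_of_linearization {u x b σ s : ℝ} (hb : 1 / 2 ≤ b) (hσ0 : 0 < σ) (hσ : σ ≤ 1)
    (hs0 : 0 ≤ s)
    (hs : s ≤ 1 / 2) (h : |b * u / √σ - x| ≤ s * (b * |u| / √σ)) :
    |u - x| ≤ (2 * (|σ - 1| + |b - 1|) + 4 * s) * |x| := by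
  have hr0 : 0 < √σ := by positivity
  have hr1 : √σ ≤ 1 := Real.sqrt_le_one.2 hσ
  have hb0 : 0 < b := by linarith
  set r := √σ / b
  have hru : |u - r * x| ≤ s * |u| := by
    have h1 : u - r * x = r * (b * u / √σ - x) := by simp only [r]; field_simp
    have hr : 0 < r := by positivity
    rw [h1, abs_mul, abs_of_pos hr]
    refine (mul_le_mul_of_nonneg_left h hr.le).trans (le_of_eq ?_)
    simp only [r]; field_simp
  have hr2 : r ≤ 2 := by
    simp only [r]; rw [div_le_iff₀ hb0]; linarith
  have hr0' : 0 < r := by positivity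
  have hu : |u| ≤ 4 * |x| := by
    have h1 : |u| ≤ |u - r * x| + |r * x| := by
      have := abs_add_le (u - r * x) (r * x); simpa using this
    rw [abs_mul, abs_of_pos hr0'] at h1
    nlinarith [abs_nonneg x, abs_nonneg u]
  have hr1' : |r - 1| ≤ 2 * (|σ - 1| + |b - 1|) := by
    have h1 : r - 1 = ((√σ - 1) - (b - 1)) / b := by simp only [r]; field_simp; ring
    have h2 : |√σ - 1| ≤ |σ - 1| := by
      have h3 : σ - 1 = (√σ - 1) * (√σ + 1) := by
        have := Real.sq_sqrt hσ0.le; linarith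
      rw [h3, abs_mul, abs_of_pos (by positivity : 0 < √σ + 1)]
      nlinarith [abs_nonneg (√σ - 1)]
    rw [h1, abs_div, abs_of_pos hb0, div_le_iff₀ hb0]
    have h4 := abs_sub (√σ - 1) (b - 1)
    nlinarith [abs_nonneg (σ - 1), abs_nonneg (b - 1)]
  have h1 : |u - x| ≤ |u - r * x| + |r - 1| * |x| := by
    rw [← abs_mul]
    have := abs_add_le (u - r * x) ((r - 1) * x)
    rwa [show u - r * x + (r - 1) * x = u - x by ring] at this
  nlinarith [abs_nonneg x, mul_le_mul_of_nonneg_left hu hs0,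
    mul_le_mul_of_nonneg_right hr1' (abs_nonneg x)]

end Rates

/-! ### Asymptotic expansions of the estimation errors -/

section Expansions

variable {z : ℕ → ℝ} {l : Filter ℕ} {q : ℕ → ℝ}

/-- The error of the exponent estimated with known scale is asymptotically `-fluct z`, after
normalization. -/
lemma tendsto_normalized_add_fluct (hz : ∀ k, 0 ≤ z k)
    (hlim : Tendsto (fun n : ℕ => (∑ k ∈ Finset.Icc 1 n, z k) / n) atTop (𝓝 1)) (hl : l ≤ atTop)
    (hG : Tendsto (fun n => fluct z n / Real.log n) l (𝓝 0))
    (hE : Tendsto (gapFluct z) l (𝓝 0))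
    (hq : ∀ᶠ n : ℕ in atTop,
      ∑ k ∈ Finset.Icc 1 n, Real.log k * ((k : ℝ) ^ (2 * q n) * z k - 1) = 0) :
    Tendsto (fun n => 2 * √(sumLogSq n) * q n + fluct z n) l (𝓝 0) := by
  have hY := tendsto_abs_add_div hG hE hl
  have hbound : Tendsto (fun n : ℕ => |gapFluct z n| +
      (16 * ((|fluct z n| + |gapFluct z n|) / Real.log n) +
        8 * (((|fluct z n| + |gapFluct z n|) / Real.log n) ^ 2 * (Real.log n ^ 2 / √n))))
      l (𝓝 0) := by
    have := hE.abs.add ((hY.const_mul 16).add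
      (((hY.pow 2).mul ((tendsto_log_pow_div_sqrt 2).mono_left hl)).const_mul 8))
    simpa using this
  refine squeeze_zero_norm' ?_ hbound
  filter_upwards [hl hq, hl eventually_one_le_log, hl (eventually_abs_mul_log_le hz hlim hq),
    hl ((tendsto_mul_log_of_root hz hlim hq).eventually_le_const
      (show (0 : ℝ) < 1 / 2 by norm_num)),
    hl ((tendsto_sum_log_sq_div hz hlim).eventually_const_le (show (1 / 2 : ℝ) < 1 by norm_num)),
    eventually_log_mul_abs_sub_one_le hz hlim hl hG,
    hl eventually_log_mul_abs_sumLogSq_sub_one_le] with n hqn hn hs hs2 hb hb4 hσ4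
  have h0 : (0 : ℝ) < n := by have := hn.1; positivity
  have hlog : 0 < Real.log n := by linarith [hn.2]
  have hsq : √(n : ℝ) ^ 2 = n := Real.sq_sqrt h0.le
  have hs0 : 0 < √(n : ℝ) := by positivity
  have hS := sumLogSq_pos hn.1
  have hlin := abs_sum_add_mul_le_of_root hz hqn (by linarith)
  have hA := sum_log_mul_sub_one z hn.1
  set g := fluct z n
  set e := gapFluct z n
  set A := ∑ k ∈ Finset.Icc 1 n, Real.log k * (z k - 1)
  set B := ∑ k ∈ Finset.Icc 1 n, Real.log k ^ 2 * z k
  set b := B / (n * Real.log n ^ 2) with hbdef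
  set σ := sumLogSq n / (n * Real.log n ^ 2) with hσdef
  set s := 2 * |q n| * Real.log n
  have hN : 0 < √(n : ℝ) * Real.log n := by positivity
  have hσ0 : 0 < σ := by positivity
  have hσ1 : σ ≤ 1 := by
    rw [hσdef, div_le_one (by positivity)]
    exact sumLogSq_le n
  have hB : B = b * (√n * Real.log n) ^ 2 := by rw [hbdef, mul_pow, hsq]; field_simp
  have hrS : √(sumLogSq n) = √σ * (√n * Real.log n) := by
    have : sumLogSq n = σ * (√n * Real.log n) ^ 2 := by rw [hσdef, mul_pow, hsq]; field_simp
    rw [this, Real.sqrt_mul hσ0.le, Real.sqrt_sq hN.le]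
  have hr0 : 0 < √σ := by positivity
  -- the normalized score at the true parameter is `g - e`
  have hx : |2 * √(sumLogSq n) * q n - (e - g)| ≤
      (2 * (|σ - 1| + |b - 1|) + 4 * s) * |e - g| := by
    refine abs_sub_le_of_linearization hb hσ0 hσ1 (by positivity) hs2 ?_
    have h1 : b * (2 * √(sumLogSq n) * q n) / √σ - (e - g) =
        (A + 2 * q n * B) / (√n * Real.log n) := by
      rw [hA, hB, hrS]; field_simp; ring
    have h2 : b * |2 * √(sumLogSq n) * q n| / √σ = (2 * |q n| * B) / (√n * Real.log n) := by
      rw [abs_mul, abs_of_nonneg (by positivity : 0 ≤ 2 * √(sumLogSq n)), hB, hrS]; field_simp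
    rw [h1, h2, abs_div, abs_of_pos hN, ← mul_div_assoc]
    gcongr
  have hs' : s ≤ 2 * ((|g| + |e|) / √n) := by
    refine hs.trans ?_
    have : A / (n * Real.log n) = (g - e) / √n := by
      rw [hA]; field_simp; rw [hsq, mul_comm]
    rw [this, abs_div, abs_of_pos hs0]
    gcongr
    exact abs_sub g e
  have hX : |e - g| ≤ |g| + |e| := by rw [abs_sub_comm]; exact abs_sub g e
  set y := |g| + |e|
  have hy0 : 0 ≤ y := by positivity
  have hσb : |σ - 1| + |b - 1| ≤ 8 / Real.log n := by
    rw [le_div_iff₀ hlog]; linarith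
  have hgoal : (2 * (|σ - 1| + |b - 1|) + 4 * s) * |e - g| ≤
      (2 * (8 / Real.log n) + 4 * (2 * (y / √n))) * y := by
    gcongr
  have hlast : (2 * (8 / Real.log n) + 4 * (2 * (y / √n))) * y =
      16 * (y / Real.log n) + 8 * ((y / Real.log n) ^ 2 * (Real.log n ^ 2 / √n)) := by
    field_simp
    ring
  have htri := abs_add_le (2 * √(sumLogSq n) * q n - (e - g)) e
  rw [show 2 * √(sumLogSq n) * q n - (e - g) + e = 2 * √(sumLogSq n) * q n + g by ring] at htri
  rw [Real.norm_eq_abs]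
  linarith

lemma tendsto_sqrt_mul_div_log_of_root (hz : ∀ k, 0 ≤ z k)
    (hlim : Tendsto (fun n : ℕ => (∑ k ∈ Finset.Icc 1 n, z k) / n) atTop (𝓝 1)) (hl : l ≤ atTop)
    (hG : Tendsto (fun n => fluct z n / Real.log n) l (𝓝 0))
    (hE : Tendsto (gapFluct z) l (𝓝 0))
    (hq : ∀ᶠ n : ℕ in atTop,
      ∑ k ∈ Finset.Icc 1 n, Real.log k * ((k : ℝ) ^ (2 * q n) * z k - 1) = 0) :
    Tendsto (fun n : ℕ => √n * q n / Real.log n) l (𝓝 0) := by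
  have h := (((tendsto_normalized_add_fluct hz hlim hl hG hE hq).mul
    (tendsto_log_natCast_atTop.inv_tendsto_atTop.mono_left hl)).sub hG).abs
  simp only [zero_mul, sub_zero, abs_zero] at h
  refine squeeze_zero_norm' ?_ h
  filter_upwards [hl eventually_one_le_log,
    hl (tendsto_sumLogSq_div.eventually_const_le (show (1 / 4 : ℝ) < 1 by norm_num))] with n hn hS
  have h0 : (0 : ℝ) < n := by have := hn.1; positivity
  have hlog : 0 < Real.log n := by linarith [hn.2]
  have h1 : √(n : ℝ) ≤ 2 * √(sumLogSq n) := by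
    rw [Real.sqrt_le_left (by positivity), mul_pow, Real.sq_sqrt (sumLogSq_pos hn.1).le]
    rw [le_div_iff₀ (by positivity)] at hS
    have : 1 ≤ Real.log n ^ 2 := one_le_pow₀ hn.2
    nlinarith
  simp only [Pi.inv_apply]
  rw [show (2 * √(sumLogSq n) * q n + fluct z n) * (Real.log n)⁻¹ - fluct z n / Real.log n =
    2 * √(sumLogSq n) * q n / Real.log n by ring, Real.norm_eq_abs, abs_div, abs_div, abs_mul,
    abs_mul, abs_of_nonneg (Real.sqrt_nonneg (n : ℝ)),
    abs_of_nonneg (by positivity : 0 ≤ 2 * √(sumLogSq n))]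
  gcongr

lemma tendsto_sqrt_mul_div_log_of_joint_root (hz : ∀ k, 0 ≤ z k)
    (hlim : Tendsto (fun n : ℕ => (∑ k ∈ Finset.Icc 1 n, z k) / n) atTop (𝓝 1)) (hl : l ≤ atTop)
    (hG : Tendsto (fun n => fluct z n / Real.log n) l (𝓝 0))
    (hE : Tendsto (gapFluct z) l (𝓝 0))
    (hq : ∀ᶠ n : ℕ in atTop, ∑ k ∈ Finset.Icc 1 n,
      (Real.log k - sumLog n / n) * ((k : ℝ) ^ (2 * q n) * z k) = 0) :
    Tendsto (fun n : ℕ => √n * q n / Real.log n) l (𝓝 0) := by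
  have h := (((tendsto_log_sub_mean_log.mono_left hl).mul hG).sub hE).abs.const_mul 64
  simp only [mul_zero, sub_zero, abs_zero] at h
  refine squeeze_zero_norm' ?_ h
  filter_upwards [hl eventually_one_le_log, hl (eventually_abs_le_of_joint_root hz hlim hq)]
    with n hn hqn
  have h0 : (0 : ℝ) < n := by have := hn.1; positivity
  have hs0 : 0 < √(n : ℝ) := by positivity
  have hlog : 0 < Real.log n := by linarith [hn.2]
  have hsq : √(n : ℝ) ^ 2 = n := Real.sq_sqrt h0.le
  have h1 : ∑ k ∈ Finset.Icc 1 n, (Real.log k - sumLog n / n) * z k =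
      √n * Real.log n *
        ((Real.log n - sumLog n / n) * (fluct z n / Real.log n) - gapFluct z n) := by
    -- the weights `log k - sumLog n / n` add up to zero
    have h2 : ∑ k ∈ Finset.Icc 1 n, (Real.log k - sumLog n / n) * z k =
        ∑ k ∈ Finset.Icc 1 n, (Real.log k - sumLog n / n) * (z k - 1) := by
      have h3 : ∑ k ∈ Finset.Icc 1 n, (Real.log k - sumLog n / n) = 0 := by
        rw [Finset.sum_sub_distrib, ← sumLog]
        simp [h0.ne', mul_div_cancel₀]
      simp only [mul_sub, mul_one, Finset.sum_sub_distrib (f := fun k : ℕ =>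
        (Real.log k - sumLog n / n) * z k), h3, sub_zero]
    rw [h2, sum_log_sub_mean_mul (fun k => z k - 1), sum_sub_one, sum_gap_sub_one z hn.1]
    field_simp
  rw [h1, abs_mul, abs_of_pos (mul_pos hs0 hlog)] at hqn
  rw [Real.norm_eq_abs, abs_div, abs_mul, abs_of_pos hs0, abs_of_pos hlog, div_le_iff₀ hlog]
  refine (mul_le_mul_of_nonneg_left hqn hs0.le).trans (le_of_eq ?_)
  field_simp
  rw [hsq]

lemma abs_sum_rpow_sub_one_sub_le (hz : ∀ k, 0 ≤ z k) {n : ℕ} {q : ℝ}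
    (hs : 2 * |q| * Real.log n ≤ 1) :
    |∑ k ∈ Finset.Icc 1 n, (k : ℝ) ^ (2 * q) * z k - ∑ k ∈ Finset.Icc 1 n, z k -
        2 * q * ∑ k ∈ Finset.Icc 1 n, Real.log k * z k| ≤
      (2 * |q| * Real.log n) ^ 2 * ∑ k ∈ Finset.Icc 1 n, z k := by
  rw [Finset.mul_sum, Finset.mul_sum, ← Finset.sum_sub_distrib, ← Finset.sum_sub_distrib]
  refine (Finset.abs_sum_le_sum_abs _ _).trans (Finset.sum_le_sum fun k hk => ?_)
  have hl := log_le_log_of_mem hk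
  rw [natCast_rpow_two_mul (Finset.mem_Icc.1 hk).1,
    show Real.exp (2 * q * Real.log k) * z k - z k - 2 * q * (Real.log k * z k) =
      (Real.exp (2 * q * Real.log k) - 1 - 2 * q * Real.log k) * z k by ring, abs_mul,
    abs_of_nonneg (hz k), sq]
  refine mul_le_mul_of_nonneg_right ((abs_exp_sub_le hl.1 hl.2 hs).trans ?_) (hz k)
  have h1 := hl.1.trans hl.2
  exact mul_le_mul_of_nonneg_left (mul_le_mul_of_nonneg_left hl.2 (by positivity)) (by positivity)

/-- Expansion of the scale, when the error `q` of the exponent is `o(log n / √n)`: to first order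
it consists of the fluctuation of `z` and of the effect of `q`. -/
lemma tendsto_scale_expansion (hz : ∀ k, 0 ≤ z k)
    (hlim : Tendsto (fun n : ℕ => (∑ k ∈ Finset.Icc 1 n, z k) / n) atTop (𝓝 1)) (hl : l ≤ atTop)
    (hG : Tendsto (fun n => fluct z n / Real.log n) l (𝓝 0))
    (hE : Tendsto (gapFluct z) l (𝓝 0))
    (hD : Tendsto (fun n : ℕ => √n * q n / Real.log n) l (𝓝 0)) :
    Tendsto (fun n : ℕ => √n * ((∑ k ∈ Finset.Icc 1 n, (k : ℝ) ^ (2 * q n) * z k) / n - 1) -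
      fluct z n - 2 * sumLog n / √n * q n) l (𝓝 0) := by
  have hlog := fun m => (tendsto_log_pow_div_sqrt m).mono_left hl
  have hs : Tendsto (fun n : ℕ => |√n * q n / Real.log n| * (Real.log n ^ 2 / √n)) l (𝓝 0) := by
    simpa using hD.abs.mul (hlog 2)
  have hEl := hE.mul (tendsto_log_natCast_atTop.inv_tendsto_atTop.mono_left hl)
  rw [zero_mul] at hEl
  have h1 := (((hD.mul (hlog 3)).mul (hG.sub hEl)).const_mul 2).abs.add
    ((((hD.pow 2).mul (hlog 4)).mul (hlim.mono_left hl)).const_mul 4)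
  simp only [mul_zero, zero_mul, abs_zero, add_zero, sub_zero] at h1
  norm_num at h1
  refine squeeze_zero_norm' ?_ h1
  filter_upwards [hl eventually_one_le_log,
    hs.eventually_le_const (show (0 : ℝ) < 1 / 2 by norm_num)] with n hn hsn
  have h0 : (0 : ℝ) < n := by have := hn.1; positivity
  have hs0 : 0 < √(n : ℝ) := by positivity
  have hlog : 0 < Real.log n := by linarith [hn.2]
  have hsq : √(n : ℝ) ^ 2 = n := Real.sq_sqrt h0.le
  have hsn' : |√n * q n / Real.log n| * (Real.log n ^ 2 / √n) = |q n| * Real.log n := by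
    rw [abs_div, abs_mul, abs_of_pos hs0, abs_of_pos hlog]; field_simp
  rw [hsn'] at hsn
  have hR := abs_sum_rpow_sub_one_sub_le hz (n := n) (q := q n) (by linarith)
  have hL : ∑ k ∈ Finset.Icc 1 n, Real.log k * z k =
      sumLog n + √n * Real.log n * (fluct z n - gapFluct z n) := by
    rw [← sum_log_mul_sub_one z hn.1, sumLog, ← Finset.sum_add_distrib]
    exact Finset.sum_congr rfl fun k _ => by ring
  have hZ : ∑ k ∈ Finset.Icc 1 n, z k = n + √n * fluct z n := by
    rw [← sum_sub_one, sum_sub_one_eq]; ring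
  set M := ∑ k ∈ Finset.Icc 1 n, (k : ℝ) ^ (2 * q n) * z k
  set Z := ∑ k ∈ Finset.Icc 1 n, z k
  set R := M - Z - 2 * q n * ∑ k ∈ Finset.Icc 1 n, Real.log k * z k with hRdef
  have hM : M = R + Z + 2 * q n * ∑ k ∈ Finset.Icc 1 n, Real.log k * z k := by rw [hRdef]; ring
  have hmain : √n * (M / n - 1) - fluct z n - 2 * sumLog n / √n * q n =
      2 * (√n * q n / Real.log n * (Real.log n ^ 3 / √n) *
        (fluct z n / Real.log n - gapFluct z n * (Real.log n)⁻¹)) + R / √n := by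
    rw [hM, hL, hZ]
    field_simp
    linear_combination (R + √n * fluct z n + 2 * q n * sumLog n +
      2 * q n * √n * Real.log n * (fluct z n - gapFluct z n)) * hsq
  have hR2 : |R / √n| ≤ 4 * ((√n * q n / Real.log n) ^ 2 * (Real.log n ^ 4 / √n) * (Z / n)) := by
    rw [abs_div, abs_of_pos hs0, div_le_iff₀ hs0]
    refine hR.trans (le_of_eq ?_)
    rw [mul_pow, mul_pow, sq_abs]
    field_simp
    rw [hsq]
    ring
  rw [hmain, Real.norm_eq_abs]
  refine (abs_add_le _ _).trans (add_le_add (le_of_eq ?_) hR2)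
  simp [abs_mul]

/-- The two rows of the normalized estimation error behave like `fluct z` and `-fluct z`. Here `α`
is the ratio of the estimated to the true scale. -/
lemma tendsto_normalized_errors (hz : ∀ k, 0 ≤ z k)
    (hlim : Tendsto (fun n : ℕ => (∑ k ∈ Finset.Icc 1 n, z k) / n) atTop (𝓝 1)) (hl : l ≤ atTop)
    (hG : Tendsto (fun n => fluct z n / Real.log n) l (𝓝 0))
    (hE : Tendsto (gapFluct z) l (𝓝 0))
    (hD : Tendsto (fun n : ℕ => √n * q n / Real.log n) l (𝓝 0)) {α : ℕ → ℝ}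
    (hα0 : ∀ n, 0 ≤ α n) (hα : ∀ᶠ n : ℕ in atTop,
      α n ^ 2 = (∑ k ∈ Finset.Icc 1 n, (k : ℝ) ^ (2 * q n) * z k) / n) :
    Tendsto (fun n : ℕ => 2 * (√n * (α n - 1) - sumLog n / √n * q n) - fluct z n) l (𝓝 0) ∧
    Tendsto (fun n : ℕ => 2 * (-(sumLog n / √(sumLogSq n)) * (α n - 1) + √(sumLogSq n) * q n) +
      fluct z n) l (𝓝 0) := by
  have hlog := fun m => (tendsto_log_pow_div_sqrt m).mono_left hl
  have hinv := tendsto_log_natCast_atTop.inv_tendsto_atTop.mono_left hl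
  have hΨ := tendsto_scale_expansion hz hlim hl hG hE hD
  -- the scale error is `o(log² n / √n)`, so that its square is negligible
  have hΨ2 : Tendsto (fun n : ℕ => √n * ((∑ k ∈ Finset.Icc 1 n, (k : ℝ) ^ (2 * q n) * z k) / n - 1)
      / Real.log n ^ 2) l (𝓝 0) := by
    have h := ((hΨ.mul hinv).add hG).mul hinv |>.add
      ((hD.mul (tendsto_sumLog_div.mono_left hl)).const_mul 2)
    simp only [zero_mul, add_zero, mul_zero] at h
    refine h.congr' ?_
    filter_upwards [hl eventually_one_le_log] with n hn
    have h0 : (0 : ℝ) < n := by have := hn.1; positivity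
    have hs0 : 0 < √(n : ℝ) := by positivity
    have hlog : 0 < Real.log n := by linarith [hn.2]
    have hsq : √(n : ℝ) ^ 2 = n := Real.sq_sqrt h0.le
    simp only [Pi.inv_apply]
    rw [show √(n : ℝ) * q n / Real.log n * (sumLog n / (n * Real.log n)) =
      sumLog n / √n * q n / Real.log n ^ 2 by
        field_simp
        linear_combination (q n * sumLog n) * hsq]
    field_simp
    ring
  have hquad : Tendsto (fun n : ℕ => √n * (α n - 1) ^ 2) l (𝓝 0) := by
    have h := (hΨ2.pow 2).mul (hlog 4)
    norm_num at h
    refine squeeze_zero' (Eventually.of_forall fun n => by positivity) ?_ h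
    filter_upwards [hl eventually_one_le_log, hl hα] with n hn hαn
    have h0 : (0 : ℝ) < n := by have := hn.1; positivity
    have hs0 : 0 < √(n : ℝ) := by positivity
    have hlog : 0 < Real.log n := by linarith [hn.2]
    rw [← hαn]
    have h1 : (√n * (α n ^ 2 - 1) / Real.log n ^ 2) ^ 2 * (Real.log n ^ 4 / √n) =
        √n * (α n ^ 2 - 1) ^ 2 := by
      field_simp
    rw [h1, show α n ^ 2 - 1 = (α n - 1) * (α n + 1) by ring, mul_pow]
    have h2 : 1 ≤ (α n + 1) ^ 2 := one_le_pow₀ (by linarith [hα0 n])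
    have h3 := mul_le_mul_of_nonneg_left h2 (sq_nonneg (α n - 1))
    rw [mul_one] at h3
    gcongr
  have hfirst : Tendsto (fun n : ℕ => 2 * (√n * (α n - 1) - sumLog n / √n * q n) - fluct z n)
      l (𝓝 0) := by
    have h := hΨ.sub hquad
    rw [sub_zero] at h
    refine h.congr' ?_
    filter_upwards [hl hα] with n hαn
    rw [← hαn]
    ring
  refine ⟨hfirst, ?_⟩
  have hσ := tendsto_sumLogSq_div.mono_left hl
  have hb1 := (hσ.inv₀ one_ne_zero).mul (hG.mul hinv).abs
  have hb2 := ((hσ.inv₀ one_ne_zero).mul hD.abs)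
  have hbound := hfirst.abs.add ((hb1.const_mul 32).add (hb2.const_mul 64))
  simp only [abs_zero, mul_zero, add_zero] at hbound
  refine squeeze_zero_norm' ?_ hbound
  filter_upwards [hl eventually_one_le_log] with n hn
  have h0 : (0 : ℝ) < n := by have := hn.1; positivity
  have hs0 : 0 < √(n : ℝ) := by positivity
  have hlog : 0 < Real.log n := by linarith [hn.2]
  have hsq : √(n : ℝ) ^ 2 = n := Real.sq_sqrt h0.le
  have hS := sumLogSq_pos hn.1
  have hrS : 0 < √(sumLogSq n) := by positivity
  have hrS2 : √(sumLogSq n) ^ 2 = sumLogSq n := Real.sq_sqrt hS.le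
  have hL := sumLog_pos hn.1
  have hgap := sumLogSq_sub_le (n := n) (by omega)
  have hCS := sumLog_sq_le n
  have hSle := sumLogSq_le n
  set S := sumLogSq n
  set L := sumLog n
  set g := fluct z n
  -- `ρ` is the correlation between the two components of the score
  set ρ := L / (√n * √S) with hρ
  have hρ0 : 0 < ρ := by positivity
  have hρ2 : ρ ^ 2 = 1 - (S - L ^ 2 / n) / S := by
    rw [hρ, div_pow, mul_pow, hsq, hrS2]; field_simp; ring
  have hgap0 : 0 ≤ S - L ^ 2 / n := by
    rw [sub_nonneg, div_le_iff₀ h0]; linarith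
  have hρ1 : ρ ≤ 1 := by
    have : 0 ≤ (S - L ^ 2 / n) / S := by positivity
    nlinarith
  have hδ : (S - L ^ 2 / n) / S ≤ 32 * n / S := by gcongr
  have hρ3 : 1 - ρ ≤ 32 * n / S := by nlinarith
  -- the second row is `-ρ` times the first one, up to terms carrying the factor `1 - ρ` or the
  -- bounded empirical variance of the logarithms
  have hdec : 2 * (-(L / √S) * (α n - 1) + √S * q n) + g =
      -ρ * (2 * (√n * (α n - 1) - L / √n * q n) - g) + ((1 - ρ) * g +
        2 * ((S - L ^ 2 / n) / √S) * q n) := by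
    have h1 : (S - L ^ 2 / n) / √S = √S - ρ * (L / √n) := by
      rw [hρ]
      field_simp
      rw [hrS2, hsq]
      field_simp
    rw [h1]
    have h2 : ρ * √n = L / √S := by rw [hρ]; field_simp
    rw [← h2]
    ring
  have hN1 : n * Real.log n ^ 2 / S * |g / Real.log n * (Real.log n)⁻¹| = n / S * |g| := by
    rw [abs_mul, abs_div, abs_of_pos hlog, abs_of_pos (inv_pos.2 hlog)]; field_simp
  have hN2 : n * Real.log n ^ 2 / S * |√n * q n / Real.log n| =
      n * Real.log n * √n / S * |q n| := by
    rw [abs_div, abs_mul, abs_of_pos hs0, abs_of_pos hlog]; field_simp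
  have hrSle : √S ≤ √n * Real.log n := by
    rw [Real.sqrt_le_left (by positivity), mul_pow, hsq]; exact hSle
  rw [Real.norm_eq_abs, hdec]
  simp only [Pi.inv_apply, inv_div]
  rw [hN1, hN2]
  refine (abs_add_le _ _).trans (add_le_add ?_ ((abs_add_le _ _).trans (add_le_add ?_ ?_)))
  · rw [abs_mul, abs_neg, abs_of_pos hρ0]
    exact mul_le_of_le_one_left (abs_nonneg _) hρ1
  · rw [abs_mul, abs_of_nonneg (by linarith : 0 ≤ 1 - ρ), ← mul_assoc, ← mul_div_assoc]
    gcongr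
  · rw [abs_mul, abs_mul, abs_two, abs_of_nonneg (by positivity : 0 ≤ (S - L ^ 2 / n) / √S),
      ← mul_assoc]
    refine mul_le_mul_of_nonneg_right ?_ (abs_nonneg _)
    have h1 : (S - L ^ 2 / n) / √S ≤ 32 * n / √S := by gcongr
    have h2 : 32 * n / √S = 32 * n * √S / S := by
      rw [div_eq_div_iff hrS.ne' hS.ne']
      linear_combination (-32 * n) * hrS2
    have h3 : 32 * n * √S / S ≤ 32 * n * (√n * Real.log n) / S := by gcongr
    calc 2 * ((S - L ^ 2 / n) / √S) ≤ 2 * (32 * n * (√n * Real.log n) / S) := by linarith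
      _ = _ := by ring

end Expansions

/-! ### Moments of the standard Gaussian law -/

section GaussianMoments

/-- The fourth moment of the standard Gaussian law, read off its moment generating function. -/
lemma iteratedDeriv_four_exp_sq_half :
    iteratedDeriv 4 (fun t : ℝ => Real.exp (t ^ 2 / 2)) 0 = 3 := by
  have he : ∀ t : ℝ, HasDerivAt (fun t : ℝ => Real.exp (t ^ 2 / 2))
      (t * Real.exp (t ^ 2 / 2)) t := fun t =>
    (((hasDerivAt_pow 2 t).div_const 2).exp).congr_deriv (by simp; ring)
  have hP : ∀ (f f' : ℝ → ℝ), (∀ t, HasDerivAt f (f' t) t) →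
      deriv (fun t => f t * Real.exp (t ^ 2 / 2)) =
        fun t => (f' t + t * f t) * Real.exp (t ^ 2 / 2) := fun f f' hf => by
    ext t
    refine ((hf t).mul (he t)).deriv.trans ?_
    ring
  have d1 : deriv (fun t : ℝ => Real.exp (t ^ 2 / 2)) = fun t => t * Real.exp (t ^ 2 / 2) :=
    funext fun t => (he t).deriv
  have d2 := hP (fun t => t) (fun _ => 1) fun t => hasDerivAt_id t
  have d3 := hP (fun t => 1 + t * t) (fun t => 2 * t) fun t =>
    (((hasDerivAt_id t).mul (hasDerivAt_id t)).const_add 1).congr_deriv (by simp; ring)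
  have d4 := hP (fun t => 2 * t + t * (1 + t * t)) (fun t => 3 + 3 * t ^ 2) fun t =>
    (((hasDerivAt_id t).const_mul 2).add ((hasDerivAt_id t).mul
      (((hasDerivAt_id t).mul (hasDerivAt_id t)).const_add 1))).congr_deriv (by simp; ring)
  rw [iteratedDeriv_succ, iteratedDeriv_succ, iteratedDeriv_succ, iteratedDeriv_one, d1, d2, d3, d4]
  simp

lemma integral_pow_four_gaussianReal : ∫ x, x ^ 4 ∂gaussianReal 0 1 = 3 := by
  have h := iteratedDeriv_mgf_zero (X := fun x : ℝ => x) (μ := gaussianReal 0 1) (by simp) 4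
  rw [mgf_fun_id_gaussianReal] at h
  simp only [zero_mul, zero_add, NNReal.coe_one, one_mul] at h
  rw [iteratedDeriv_four_exp_sq_half] at h
  exact h.symm

lemma integral_sq_gaussianReal : ∫ x, x ^ 2 ∂gaussianReal 0 1 = 1 := by
  have h := variance_of_integral_eq_zero (μ := gaussianReal 0 1) (X := fun x : ℝ => x)
    (by fun_prop) integral_id_gaussianReal
  rw [variance_fun_id_gaussianReal] at h
  simpa using h.symm

lemma memLp_sq_gaussianReal : MemLp (fun x : ℝ => x ^ 2) 2 (gaussianReal 0 1) := by
  refine (memLp_two_iff_integrable_sq (by fun_prop)).2 ?_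
  have h := integrable_pow_of_mem_interior_integrableExpSet (X := fun x : ℝ => x)
    (μ := gaussianReal 0 1) (by simp) 4
  refine h.congr (ae_of_all _ fun x => ?_)
  ring

lemma variance_sq_gaussianReal : Var[fun x : ℝ => x ^ 2; gaussianReal 0 1] = 2 := by
  rw [variance_eq_sub memLp_sq_gaussianReal]
  simp only [Pi.pow_apply, ← pow_mul]
  norm_num [integral_pow_four_gaussianReal, integral_sq_gaussianReal]

end GaussianMoments

/-! ### Limit theorems for the squared coefficients -/

section Probability

/-- The mean `(Y_k² + Y'_k²) / 2` of the squared standardized coefficients of frequency `k`. For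
standard Gaussian coefficients it has mean `1` and variance `1`. -/
noncomputable def meanSq {Ω : Type*} (Y Y' : ℕ → Ω → ℝ) (ω : Ω) (k : ℕ) : ℝ :=
  (Y k ω ^ 2 + Y' k ω ^ 2) / 2

lemma meanSq_nonneg {Ω : Type*} (Y Y' : ℕ → Ω → ℝ) (ω : Ω) (k : ℕ) : 0 ≤ meanSq Y Y' ω k := by
  unfold meanSq; positivity

variable {Ω : Type*} [MeasurableSpace Ω] {P : Measure Ω}

/-- A weak law of large numbers for weighted sums, from Chebyshev's inequality. -/
lemma tendstoInMeasure_weighted_sum [IsProbabilityMeasure P] {ι : Type*} {X : ι → Ω → ℝ} {v : ℝ}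
    (hX : ∀ i, MemLp (X i) 2 P) (hmean : ∀ i, P[X i] = 0) (hvar : ∀ i, Var[X i; P] = v)
    (hind : Pairwise fun i j => X i ⟂ᵢ[P] X j) (s : ℕ → Finset ι) (w : ℕ → ι → ℝ)
    (hw : Tendsto (fun n => ∑ i ∈ s n, w n i ^ 2) atTop (𝓝 0)) :
    TendstoInMeasure P (fun n ω => ∑ i ∈ s n, w n i * X i ω) atTop (fun _ => 0) := by
  have hL : ∀ n, ∀ i, MemLp (fun ω => w n i * X i ω) 2 P := fun n i => (hX i).const_mul _
  have hLs : ∀ n, MemLp (fun ω => ∑ i ∈ s n, w n i * X i ω) 2 P := fun n =>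
    memLp_finsetSum _ fun i _ => hL n i
  have hm : ∀ n, P[fun ω => ∑ i ∈ s n, w n i * X i ω] = 0 := fun n => by
    rw [integral_finsetSum _ fun i _ => (hL n i).integrable one_le_two]
    exact Finset.sum_eq_zero fun i _ => by rw [integral_const_mul, hmean, mul_zero]
  have hv : ∀ n, Var[fun ω => ∑ i ∈ s n, w n i * X i ω; P] = (∑ i ∈ s n, w n i ^ 2) * v := by
    intro n
    have h := IndepFun.variance_sum (s := s n) (X := fun i ω => w n i * X i ω) (μ := P)
      (fun i _ => hL n i) fun i _ j _ hij =>
        (hind hij).comp (measurable_const_mul (w n i)) (measurable_const_mul (w n j))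
    rw [Finset.sum_mul]
    have e : (∑ i ∈ s n, fun ω => w n i * X i ω) = fun ω => ∑ i ∈ s n, w n i * X i ω := by
      ext ω; simp
    rw [e] at h
    rw [h]
    exact Finset.sum_congr rfl fun i _ => by rw [variance_const_mul, hvar]
  rw [tendstoInMeasure_iff_norm]
  intro ε hε
  have hlim : Tendsto (fun n => ENNReal.ofReal ((∑ i ∈ s n, w n i ^ 2) * v / ε ^ 2)) atTop
      (𝓝 0) := by
    have h := ENNReal.tendsto_ofReal ((hw.mul_const v).div_const (ε ^ 2))
    simpa using h
  refine tendsto_of_tendsto_of_tendsto_of_le_of_le tendsto_const_nhds hlim (fun _ => zero_le)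
    fun n => ?_
  have h := meas_ge_le_variance_div_sq (hLs n) hε
  rw [hm, hv] at h
  simpa using h

variable {Y Y' : ℕ → Ω → ℝ}

lemma hasLaw_sumElim (hY : ∀ k, HasLaw (Y k) (gaussianReal 0 1) P)
    (hY' : ∀ k, HasLaw (Y' k) (gaussianReal 0 1) P) (i : ℕ ⊕ ℕ) :
    HasLaw (Sum.elim Y Y' i) (gaussianReal 0 1) P := by
  cases i <;> simp [hY, hY']

lemma ae_meanSq_pos (hY : ∀ k, HasLaw (Y k) (gaussianReal 0 1) P) :
    ∀ᵐ ω ∂P, ∀ k, 0 < meanSq Y Y' ω k := by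
  rw [ae_all_iff]
  intro k
  have := nullSingletonClass_gaussianReal (μ := 0) (v := 1) one_ne_zero
  have h : ∀ᵐ ω ∂P, Y k ω ≠ 0 := by
    rw [(hY k).ae_iff (p := fun x => x ≠ 0)
      (measurableSet_setOfPred.1 (measurableSet_singleton 0).compl)]
    exact Measure.ae_ne _ 0
  filter_upwards [h] with ω hω
  unfold meanSq
  positivity

lemma memLp_sq_sub_one [IsProbabilityMeasure P] {U : Ω → ℝ} (hU : HasLaw U (gaussianReal 0 1) P) :
    MemLp (fun ω => U ω ^ 2 - 1) 2 P :=
  (((hU.map_eq ▸ memLp_sq_gaussianReal :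
    MemLp (fun x : ℝ => x ^ 2) 2 (P.map U)).comp_of_map hU.aemeasurable)).sub (memLp_const 1)

lemma integrable_sq_of_hasLaw [IsProbabilityMeasure P] {U : Ω → ℝ}
    (hU : HasLaw U (gaussianReal 0 1) P) : Integrable (fun ω => U ω ^ 2) P :=
  (((memLp_sq_sub_one hU).integrable one_le_two).add (integrable_const 1)).congr
    (ae_of_all _ fun _ => sub_add_cancel _ _)

lemma integral_sq_of_hasLaw {U : Ω → ℝ} (hU : HasLaw U (gaussianReal 0 1) P) :
    ∫ ω, U ω ^ 2 ∂P = 1 := by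
  rw [← integral_sq_gaussianReal]
  exact hU.integral_comp (f := fun x : ℝ => x ^ 2) (by fun_prop)

lemma integral_sq_sub_one [IsProbabilityMeasure P] {U : Ω → ℝ}
    (hU : HasLaw U (gaussianReal 0 1) P) : ∫ ω, (U ω ^ 2 - 1) ∂P = 0 := by
  rw [integral_sub (integrable_sq_of_hasLaw hU) (integrable_const 1), integral_sq_of_hasLaw hU]
  simp

lemma variance_sq_sub_one [IsProbabilityMeasure P] {U : Ω → ℝ}
    (hU : HasLaw U (gaussianReal 0 1) P) : Var[fun ω => U ω ^ 2 - 1; P] = 2 := by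
  have hm : AEMeasurable (fun x : ℝ => x ^ 2) (P.map U) := by fun_prop
  rw [variance_sub_const (hU.aemeasurable.pow_const 2).aestronglyMeasurable,
    ← variance_sq_gaussianReal, ← hU.map_eq, variance_map hm hU.aemeasurable]
  rfl

lemma ae_tendsto_sum_meanSq_div [IsProbabilityMeasure P]
    (hY : ∀ k, HasLaw (Y k) (gaussianReal 0 1) P) (hY' : ∀ k, HasLaw (Y' k) (gaussianReal 0 1) P)
    (hind : iIndepFun (Sum.elim Y Y') P) :
    ∀ᵐ ω ∂P, Tendsto (fun n : ℕ => (∑ k ∈ Finset.Icc 1 n, meanSq Y Y' ω k) / n) atTop (𝓝 1) := by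
  have key : ∀ e : ℕ → ℕ ⊕ ℕ, e.Injective → ∀ᵐ ω ∂P, Tendsto
      (fun n : ℕ => (∑ k ∈ Finset.range n, Sum.elim Y Y' (e k) ω ^ 2) / n) atTop (𝓝 1) := by
    intro e he
    have hlaw := hasLaw_sumElim hY hY'
    have h := strong_law_ae_real (μ := P) (fun k ω => Sum.elim Y Y' (e k) ω ^ 2) ?_ ?_ ?_
    · rwa [integral_sq_of_hasLaw (hlaw _)] at h
    · exact integrable_sq_of_hasLaw (hlaw (e 0))
    · intro i j hij
      exact (hind.indepFun (he.ne hij)).comp (measurable_id.pow_const 2) (measurable_id.pow_const 2)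
    · intro i
      exact ((hlaw (e i)).identDistrib (hlaw (e 0))).comp (measurable_id.pow_const 2)
  filter_upwards [key (fun k => Sum.inl (k + 1)) fun i j h => by simpa using h,
    key (fun k => Sum.inr (k + 1)) fun i j h => by simpa using h] with ω h1 h2
  have h := (h1.add h2).div_const 2
  norm_num at h
  refine h.congr fun n => ?_
  rw [Finset.range_eq_Ico, Finset.sum_Ico_add' (fun k => Y k ω ^ 2) 0 n 1,
    Finset.sum_Ico_add' (fun k => Y' k ω ^ 2) 0 n 1, ← add_div, ← Finset.sum_add_distrib]
  simp only [meanSq, ← Finset.sum_div, zero_add, Finset.Ico_add_one_right_eq_Icc]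
  ring

/-- The weighted law of large numbers applied to the union of the sequences `Y` and `Y'`, both with
the weights `w n k / 2`. -/
lemma tendstoInMeasure_sum_meanSq [IsProbabilityMeasure P]
    (hY : ∀ k, HasLaw (Y k) (gaussianReal 0 1) P) (hY' : ∀ k, HasLaw (Y' k) (gaussianReal 0 1) P)
    (hind : iIndepFun (Sum.elim Y Y') P) (w : ℕ → ℕ → ℝ)
    (hw : Tendsto (fun n => ∑ k ∈ Finset.Icc 1 n, w n k ^ 2) atTop (𝓝 0)) :
    TendstoInMeasure P (fun n ω => ∑ k ∈ Finset.Icc 1 n, w n k * (meanSq Y Y' ω k - 1))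
      atTop (fun _ => 0) := by
  have hlaw := hasLaw_sumElim hY hY'
  have h := tendstoInMeasure_weighted_sum (P := P)
    (X := fun i ω => Sum.elim Y Y' i ω ^ 2 - 1) (v := 2) (fun i => memLp_sq_sub_one (hlaw i))
    (fun i => integral_sq_sub_one (hlaw i)) (fun i => variance_sq_sub_one (hlaw i))
    (fun i j hij => (hind.indepFun hij).comp (φ := fun x => x ^ 2 - 1) (ψ := fun x => x ^ 2 - 1)
      (by fun_prop) (by fun_prop))
    (fun n => (Finset.Icc 1 n).disjSum (Finset.Icc 1 n))
    (fun n => Sum.elim (fun k => w n k / 2) (fun k => w n k / 2)) ?_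
  · refine h.congr_left fun n => ae_of_all _ fun ω => ?_
    simp only [Finset.sum_disjSum, Sum.elim_inl, Sum.elim_inr, ← Finset.sum_add_distrib, meanSq]
    exact Finset.sum_congr rfl fun k _ => by ring
  · have h2 := hw.div_const 2
    rw [zero_div] at h2
    refine h2.congr fun n => ?_
    simp only [Finset.sum_disjSum, Sum.elim_inl, Sum.elim_inr, ← Finset.sum_add_distrib,
      Finset.sum_div]
    exact Finset.sum_congr rfl fun k _ => by ring

lemma tendstoInMeasure_fluct_div_log [IsProbabilityMeasure P]
    (hY : ∀ k, HasLaw (Y k) (gaussianReal 0 1) P) (hY' : ∀ k, HasLaw (Y' k) (gaussianReal 0 1) P)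
    (hind : iIndepFun (Sum.elim Y Y') P) :
    TendstoInMeasure P (fun (n : ℕ) ω => fluct (meanSq Y Y' ω) n / Real.log n) atTop
      (fun _ => 0) := by
  refine (tendstoInMeasure_sum_meanSq hY hY' hind (fun n _ => (√n * Real.log n)⁻¹) ?_).congr_left
    fun n => ae_of_all _ fun ω => ?_
  · have h := (tendsto_log_natCast_atTop.inv_tendsto_atTop).pow 2
    norm_num at h
    refine h.congr' ?_
    filter_upwards [eventually_gt_atTop 0] with n hn
    have h0 : (0 : ℝ) < n := by exact_mod_cast hn
    simp only [Finset.sum_const, Nat.card_Icc, nsmul_eq_mul, add_tsub_cancel_right,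
      mul_inv, mul_pow, inv_pow, Real.sq_sqrt h0.le]
    field_simp
  · simp only [fluct]
    rw [← Finset.mul_sum, mul_inv, div_eq_mul_inv, div_eq_mul_inv]
    ring

lemma tendstoInMeasure_gapFluct [IsProbabilityMeasure P]
    (hY : ∀ k, HasLaw (Y k) (gaussianReal 0 1) P) (hY' : ∀ k, HasLaw (Y' k) (gaussianReal 0 1) P)
    (hind : iIndepFun (Sum.elim Y Y') P) :
    TendstoInMeasure P (fun (n : ℕ) ω => gapFluct (meanSq Y Y' ω) n) atTop (fun _ => 0) := by
  refine (tendstoInMeasure_sum_meanSq hY hY' hind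
    (fun n k => (Real.log n - Real.log k) * (√n * Real.log n)⁻¹) ?_).congr_left
    fun n => ae_of_all _ fun ω => ?_
  · have h := ((tendsto_log_natCast_atTop.inv_tendsto_atTop).pow 2).const_mul 32
    norm_num at h
    refine squeeze_zero' (Eventually.of_forall fun n => by positivity) ?_ h
    filter_upwards [eventually_gt_atTop 0] with n hn
    have h0 : (0 : ℝ) < n := by exact_mod_cast hn
    simp only [mul_pow, ← Finset.sum_mul, inv_pow, Real.sq_sqrt h0.le]
    calc _ ≤ 32 * (n : ℝ) * (n * Real.log n ^ 2)⁻¹ := by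
          gcongr
          exact sum_log_gap_sq_le n
      _ = _ := by rw [mul_inv]; field_simp
  · simp only [gapFluct, div_eq_mul_inv, Finset.sum_mul]
    exact Finset.sum_congr rfl fun k _ => by ring

lemma sum_range_two_mul (f : ℕ → ℝ) (n : ℕ) :
    ∑ j ∈ Finset.range (2 * n), f j = ∑ k ∈ Finset.range n, (f (2 * k) + f (2 * k + 1)) := by
  induction n with
  | zero => simp
  | succ n ih =>
    rw [show 2 * (n + 1) = 2 * n + 1 + 1 by ring, Finset.sum_range_succ, Finset.sum_range_succ, ih,
      Finset.sum_range_succ]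
    ring

/-- The central limit theorem is applied to the squares of the interlaced sequence
`Y 1, Y' 1, Y 2, Y' 2, …`, along even indices. -/
lemma tendstoInDistribution_fluct [IsProbabilityMeasure P]
    (hY : ∀ k, HasLaw (Y k) (gaussianReal 0 1) P) (hY' : ∀ k, HasLaw (Y' k) (gaussianReal 0 1) P)
    (hind : iIndepFun (Sum.elim Y Y') P) {Z : ℝ → ℝ}
    (hZ : HasLaw Z (gaussianReal 0 1) (gaussianReal 0 1)) :
    TendstoInDistribution (fun (n : ℕ) ω => fluct (meanSq Y Y' ω) n) atTop Z (fun _ => P)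
      (gaussianReal 0 1) := by
  have hlaw := hasLaw_sumElim hY hY'
  let e : ℕ → ℕ ⊕ ℕ := fun j => Sum.map (· + 1) (· + 1) (Equiv.natSumNatEquivNat.symm j)
  have he : e.Injective := (Sum.map_injective.2
    ⟨add_left_injective 1, add_left_injective 1⟩).comp Equiv.natSumNatEquivNat.symm.injective
  have he0 : ∀ k, e (2 * k) = Sum.inl (k + 1) := fun k => by simp [e]
  have he1 : ∀ k, e (2 * k + 1) = Sum.inr (k + 1) := fun k => by simp [e]
  have hm : Measurable fun x : ℝ => (x ^ 2 - 1) / √2 := by fun_prop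
  have h := tendstoInDistribution_inv_sqrt_mul_sum (P := P) hZ
    (X := fun j ω => (Sum.elim Y Y' (e j) ω ^ 2 - 1) / √2) ?_ ?_
    ((hind.precomp he).comp (fun _ x => (x ^ 2 - 1) / √2) fun _ => hm)
    fun i => ((hlaw (e i)).identDistrib (hlaw (e 0))).comp hm
  · have h2 : Tendsto (fun n : ℕ => 2 * n) atTop atTop :=
      tendsto_id.const_mul_atTop' two_pos
    have h3 : TendstoInDistribution (fun (n : ℕ) ω => (√(2 * n : ℕ))⁻¹ *
        ∑ j ∈ Finset.range (2 * n), (Sum.elim Y Y' (e j) ω ^ 2 - 1) / √2) atTop Z (fun _ => P)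
        (gaussianReal 0 1) :=
      ⟨fun n => h.forall_aemeasurable (2 * n), h.aemeasurable_limit, h.tendsto.comp h2⟩
    refine h3.congr (fun n => ae_of_all _ fun ω => ?_) EventuallyEq.rfl
    simp only [sum_range_two_mul, he0, he1, Sum.elim_inl, Sum.elim_inr, fluct, meanSq]
    rw [Finset.range_eq_Ico, Finset.sum_Ico_add'
      (fun k => (Y k ω ^ 2 - 1) / √2 + (Y' k ω ^ 2 - 1) / √2) 0 n 1, zero_add,
      Finset.Ico_add_one_right_eq_Icc, div_eq_inv_mul, Nat.cast_mul, Nat.cast_ofNat,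
      Real.sqrt_mul two_pos.le, mul_inv, Finset.mul_sum, Finset.mul_sum]
    refine Finset.sum_congr rfl fun k _ => ?_
    have hs : √(2 : ℝ) * √2 = 2 := Real.mul_self_sqrt two_pos.le
    have hs' : (√(2 : ℝ))⁻¹ * (√2)⁻¹ = 2⁻¹ := by rw [← mul_inv, hs]
    rw [← add_div, div_eq_mul_inv _ √2]
    linear_combination (√(n : ℝ))⁻¹ * (Y k ω ^ 2 - 1 + (Y' k ω ^ 2 - 1)) * hs'
  · rw [integral_div, integral_sq_sub_one (hlaw _), zero_div]
  · have hv := variance_sq_sub_one (hlaw (e 0))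
    rw [variance_of_integral_eq_zero (memLp_sq_sub_one (hlaw _)).aemeasurable
      (integral_sq_sub_one (hlaw _))] at hv
    simp only [Pi.pow_apply, div_pow, integral_div, hv]
    norm_num

end Probability

/-! ### The sample of the model -/

section ModelSample

variable {n : ℕ} {a₀ p₀ : ℝ} {y : Sample n} {z : ℕ → ℝ}

lemma power_fourierSample_modelPath {Ω : Type*} (n : ℕ) (a p : ℝ) (Y Y' : ℕ → Ω → ℝ) (ω : Ω)
    (k : Finset.Icc 1 n) :
    power (fourierSample n (modelPath n a p (fun k => Y k ω) (fun k => Y' k ω))) k =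
      2 * (a / ((k : ℕ) : ℝ) ^ p) ^ 2 * meanSq Y Y' ω k := by
  rw [power, fourierSample_modelPath, meanSq]
  ring

lemma rpow_mul_power (hy : ∀ k, power y k = 2 * (a₀ / ((k : ℕ) : ℝ) ^ p₀) ^ 2 * z k) (p : ℝ)
    (k : Finset.Icc 1 n) : ((k : ℕ) : ℝ) ^ (2 * p) * power y k =
      2 * a₀ ^ 2 * (((k : ℕ) : ℝ) ^ (2 * (p - p₀)) * z k) := by
  have hk := pos_of_mem k
  have h0 : 0 < ((k : ℕ) : ℝ) ^ p₀ := Real.rpow_pos_of_pos hk _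
  have h : ((k : ℕ) : ℝ) ^ (2 * (p - p₀)) = ((k : ℕ) : ℝ) ^ (2 * p) / (((k : ℕ) : ℝ) ^ p₀) ^ 2 := by
    rw [mul_sub, Real.rpow_sub hk, mul_comm 2 p₀, Real.rpow_mul hk.le p₀]
    norm_num
  rw [hy, h]
  field_simp

lemma scoreP_model (ha : 0 < a₀)
    (hy : ∀ k, power y k = 2 * (a₀ / ((k : ℕ) : ℝ) ^ p₀) ^ 2 * z k) (p : ℝ) :
    scoreP y a₀ p =
      -2 * ∑ k ∈ Finset.Icc 1 n, Real.log k * ((k : ℝ) ^ (2 * (p - p₀)) * z k - 1) := by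
  rw [scoreP, ← Finset.sum_coe_sort (Finset.Icc 1 n), Finset.mul_sum]
  refine Finset.sum_congr rfl fun k _ => ?_
  rw [rpow_mul_power hy]
  field_simp
  ring

lemma sum_rpow_mul_power_model
    (hy : ∀ k, power y k = 2 * (a₀ / ((k : ℕ) : ℝ) ^ p₀) ^ 2 * z k) (p : ℝ) (c : ℕ → ℝ) :
    ∑ k : Finset.Icc 1 n, c k * (((k : ℕ) : ℝ) ^ (2 * p) * power y k) =
      2 * a₀ ^ 2 * ∑ k ∈ Finset.Icc 1 n, c k * ((k : ℝ) ^ (2 * (p - p₀)) * z k) := by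
  rw [← Finset.sum_coe_sort (Finset.Icc 1 n), Finset.mul_sum]
  refine Finset.sum_congr rfl fun k _ => ?_
  rw [rpow_mul_power hy]
  ring

lemma power_model_pos (ha : 0 < a₀)
    (hy : ∀ k, power y k = 2 * (a₀ / ((k : ℕ) : ℝ) ^ p₀) ^ 2 * z k) (hz : ∀ k, 0 < z k)
    (k : Finset.Icc 1 n) : 0 < power y k := by
  have := Real.rpow_pos_of_pos (pos_of_mem k) p₀
  have := hz k
  rw [hy]
  positivity

lemma root_expKnownScale (ha : 0 < a₀)
    (hy : ∀ k, power y k = 2 * (a₀ / ((k : ℕ) : ℝ) ^ p₀) ^ 2 * z k) (hz : ∀ k, 0 < z k) :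
    ∑ k ∈ Finset.Icc 1 n,
      Real.log k * ((k : ℝ) ^ (2 * (expKnownScale n a₀ y - p₀)) * z k - 1) = 0 := by
  have h := scoreP_expKnownScale ha (power_model_pos ha hy hz)
  rw [scoreP_model ha hy] at h
  linarith

lemma root_expJoint (ha : 0 < a₀)
    (hy : ∀ k, power y k = 2 * (a₀ / ((k : ℕ) : ℝ) ^ p₀) ^ 2 * z k) (hz : ∀ k, 0 < z k)
    (hn : 2 ≤ n) :
    ∑ k ∈ Finset.Icc 1 n, (Real.log k - sumLog n / n) *
      ((k : ℝ) ^ (2 * (expJoint n y - p₀)) * z k) = 0 := by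
  have h := sum_expJoint hn (power_model_pos ha hy hz)
  rw [sum_rpow_mul_power_model hy _ fun k => Real.log k - sumLog n / n] at h
  exact (mul_eq_zero.1 h).resolve_left (by positivity)

lemma scaleOf_div_sq (ha : 0 < a₀)
    (hy : ∀ k, power y k = 2 * (a₀ / ((k : ℕ) : ℝ) ^ p₀) ^ 2 * z k) (hz : ∀ k, 0 < z k)
    (hn : 1 ≤ n) (p : ℝ) :
    (scaleOf n p y / a₀) ^ 2 = (∑ k ∈ Finset.Icc 1 n, (k : ℝ) ^ (2 * (p - p₀)) * z k) / n := by
  have h := sum_rpow_mul_power_model hy p fun _ => 1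
  simp only [one_mul] at h
  rw [div_pow, scaleOf_sq hn (power_model_pos ha hy hz), h]
  field_simp

end ModelSample

/-! ### Limits in distribution -/

section Limits

variable {Ω : Type*} [MeasurableSpace Ω] {P : Measure Ω}

/-- Subsequence principle: a pathwise implication between limits along arbitrary filters below
`atTop` carries over to convergence in probability. -/
lemma tendstoInMeasure_of_forall_filter [IsProbabilityMeasure P] {E : Type*} [NormedAddCommGroup E]
    {g e : ℕ → Ω → ℝ} {f : ℕ → Ω → E}
    (hg : TendstoInMeasure P g atTop fun _ => 0) (he : TendstoInMeasure P e atTop fun _ => 0)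
    (hf : ∀ n, AEStronglyMeasurable (f n) P)
    (h : ∀ᵐ ω ∂P, ∀ l : Filter ℕ, l ≤ atTop → Tendsto (fun n => g n ω) l (𝓝 0) →
      Tendsto (fun n => e n ω) l (𝓝 0) → Tendsto (fun n => f n ω) l (𝓝 0)) :
    TendstoInMeasure P f atTop fun _ => 0 := by
  rw [exists_seq_tendstoInMeasure_atTop_iff hf]
  intro ns hns
  obtain ⟨m₁, hm₁, h₁⟩ := (hg.comp hns.tendsto_atTop).exists_seq_tendsto_ae
  obtain ⟨m₂, hm₂, h₂⟩ := (he.comp (hns.comp hm₁).tendsto_atTop).exists_seq_tendsto_ae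
  refine ⟨m₁ ∘ m₂, hm₁.comp hm₂, ?_⟩
  filter_upwards [h, h₁, h₂] with ω h h₁ h₂
  have h' := h (map (ns ∘ m₁ ∘ m₂) atTop) (hns.comp (hm₁.comp hm₂)).tendsto_atTop
    (tendsto_map'_iff.2 (h₁.comp hm₂.tendsto_atTop)) (tendsto_map'_iff.2 h₂)
  exact tendsto_map'_iff.1 h'

variable {Y Y' : ℕ → Ω → ℝ} {a₀ p₀ : ℝ} {y : (n : ℕ) → Ω → Sample n}

lemma aemeasurable_sample (hY : ∀ k, HasLaw (Y k) (gaussianReal 0 1) P)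
    (hY' : ∀ k, HasLaw (Y' k) (gaussianReal 0 1) P)
    (hy : ∀ n ω, y n ω = fourierSample n (modelPath n a₀ p₀ (fun k => Y k ω) (fun k => Y' k ω)))
    (n : ℕ) : AEMeasurable (y n) P := by
  rw [aemeasurable_pi_iff]
  intro k
  have e : (fun ω => y n ω k) =
      fun ω => (a₀ / ((k : ℕ) : ℝ) ^ p₀ * Y k ω, a₀ / ((k : ℕ) : ℝ) ^ p₀ * Y' k ω) := by
    ext1 ω
    rw [hy, fourierSample_modelPath]
  rw [e]
  exact ((hY k).aemeasurable.const_mul _).prodMk ((hY' k).aemeasurable.const_mul _)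

/-- Any estimator whose exponent is within `o(log n / √n)` of `p₀` in probability, completed by the
corresponding zero of the score in `a`, satisfies the degenerate joint limit theorem. -/
lemma tendstoInDistribution_joint [IsProbabilityMeasure P]
    (hY : ∀ k, HasLaw (Y k) (gaussianReal 0 1) P)
    (hY' : ∀ k, HasLaw (Y' k) (gaussianReal 0 1) P) (hind : iIndepFun (Sum.elim Y Y') P)
    (ha : 0 < a₀)
    (hy : ∀ n ω, y n ω = fourierSample n (modelPath n a₀ p₀ (fun k => Y k ω) (fun k => Y' k ω)))
    {p : (n : ℕ) → Sample n → ℝ} (hp : ∀ n, Measurable (p n))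
    (hrate : ∀ᵐ ω ∂P, ∀ l : Filter ℕ, l ≤ atTop →
      Tendsto (fun n : ℕ => fluct (meanSq Y Y' ω) n / Real.log n) l (𝓝 0) →
      Tendsto (gapFluct (meanSq Y Y' ω)) l (𝓝 0) →
      Tendsto (fun n : ℕ => √n * (p n (y n ω) - p₀) / Real.log n) l (𝓝 0)) :
    TendstoInDistribution
      (fun (n : ℕ) ω => (normMatrix n a₀).mulVec
        ![scaleOf n (p n (y n ω)) (y n ω) - a₀, p n (y n ω) - p₀])
      atTop (fun z : ℝ => z • ![1, -1]) (fun _ => P) (gaussianReal 0 1) := by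
  have hclt := tendstoInDistribution_fluct hY hY' hind (Z := id) HasLaw.id
  have hbase := hclt.continuous_comp (g := fun z : ℝ => z • (![1, -1] : Fin 2 → ℝ)) (by fun_prop)
  have hmeas : ∀ n, AEMeasurable (fun ω => (normMatrix n a₀).mulVec
      ![scaleOf n (p n (y n ω)) (y n ω) - a₀, p n (y n ω) - p₀]) P := by
    intro n
    have h1 : Measurable fun x : Sample n => (normMatrix n a₀).mulVec
        ![scaleOf n (p n x) x - a₀, p n x - p₀] := by
      have hs := measurable_scaleOf n (hp n)
      have hpn := hp n
      rw [measurable_pi_iff]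
      intro i
      simp only [Matrix.mulVec, dotProduct, Fin.sum_univ_two, Matrix.cons_val_zero,
        Matrix.cons_val_one]
      fun_prop
    exact h1.comp_aemeasurable (aemeasurable_sample hY hY' hy n)
  refine tendstoInDistribution_of_tendstoInMeasure_sub _ _ hbase ?_ hmeas
  refine tendstoInMeasure_of_forall_filter (tendstoInMeasure_fluct_div_log hY hY' hind)
    (tendstoInMeasure_gapFluct hY hY' hind)
    (fun n => ((hmeas n).sub (hbase.forall_aemeasurable n)).aestronglyMeasurable) ?_
  filter_upwards [hrate, ae_meanSq_pos hY, ae_tendsto_sum_meanSq_div hY hY' hind]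
    with ω hrate hpos hlim l hl hG hE
  have hpow : ∀ n k, power (y n ω) k =
      2 * (a₀ / ((k : ℕ) : ℝ) ^ p₀) ^ 2 * meanSq Y Y' ω k := fun n k => by
    rw [hy, power_fourierSample_modelPath]
  obtain ⟨h0, h1⟩ := tendsto_normalized_errors (fun k => (hpos k).le) hlim hl hG hE
    (hrate l hl hG hE) (α := fun n => scaleOf n (p n (y n ω)) (y n ω) / a₀)
    (fun n => div_nonneg (scaleOf_pos _ _).le ha.le)
    ((eventually_ge_atTop 1).mono fun n hn => scaleOf_div_sq ha (hpow n) hpos hn _)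
  rw [tendsto_pi_nhds]
  intro i
  fin_cases i
  · refine h0.congr fun n => ?_
    simp [normMatrix]
    field_simp
    ring
  · refine h1.congr fun n => ?_
    simp [normMatrix]
    field_simp

lemma tendstoInDistribution_known [IsProbabilityMeasure P]
    (hY : ∀ k, HasLaw (Y k) (gaussianReal 0 1) P)
    (hY' : ∀ k, HasLaw (Y' k) (gaussianReal 0 1) P) (hind : iIndepFun (Sum.elim Y Y') P)
    (ha : 0 < a₀)
    (hy : ∀ n ω, y n ω = fourierSample n (modelPath n a₀ p₀ (fun k => Y k ω) (fun k => Y' k ω))) :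
    TendstoInDistribution
      (fun (n : ℕ) ω => 2 * √(sumLogSq n) * (expKnownScale n a₀ (y n ω) - p₀))
      atTop (fun z : ℝ => z) (fun _ => P) (gaussianReal 0 1) := by
  -- the standard Gaussian law is symmetric
  have hneg : HasLaw (fun z : ℝ => -z) (gaussianReal 0 1) (gaussianReal 0 1) :=
    ⟨by fun_prop, by rw [gaussianReal_map_neg, neg_zero]⟩
  have hbase := (tendstoInDistribution_fluct hY hY' hind hneg).continuous_comp
    (g := fun z : ℝ => -z) continuous_neg
  have hbase' : TendstoInDistribution
      (fun (n : ℕ) => (fun z : ℝ => -z) ∘ fun ω => fluct (meanSq Y Y' ω) n) atTop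
      (fun z : ℝ => z) (fun _ => P) (gaussianReal 0 1) :=
    hbase.congr (fun _ => EventuallyEq.rfl) (ae_of_all _ fun z => by simp)
  have hmeas : ∀ n, AEMeasurable
      (fun ω => 2 * √(sumLogSq n) * (expKnownScale n a₀ (y n ω) - p₀)) P := fun n =>
    (((measurable_expKnownScale n a₀).comp_aemeasurable
      (aemeasurable_sample hY hY' hy n)).sub_const p₀).const_mul _
  refine tendstoInDistribution_of_tendstoInMeasure_sub _ _ hbase' ?_ hmeas
  refine tendstoInMeasure_of_forall_filter (tendstoInMeasure_fluct_div_log hY hY' hind)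
    (tendstoInMeasure_gapFluct hY hY' hind)
    (fun n => ((hmeas n).sub (hbase'.forall_aemeasurable n)).aestronglyMeasurable) ?_
  filter_upwards [ae_meanSq_pos hY, ae_tendsto_sum_meanSq_div hY hY' hind]
    with ω hpos hlim l hl hG hE
  refine (tendsto_normalized_add_fluct (fun k => (hpos k).le) hlim hl hG hE
    (q := fun n => expKnownScale n a₀ (y n ω) - p₀) (Eventually.of_forall fun n =>
      root_expKnownScale ha (fun k => by rw [hy, power_fourierSample_modelPath]) hpos)).congr
    fun n => ?_
  simp

end Limits

end PeriodicGaussian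

open PeriodicGaussian in
theorem mainTheorem8 :
    ∃ (pKnown aKnown : (n : ℕ) → ℝ → PeriodicGaussian.Sample n → ℝ)
      (aHat pHat : (n : ℕ) → PeriodicGaussian.Sample n → ℝ),
      (∀ n a, Measurable (pKnown n a)) ∧ (∀ n a, Measurable (aKnown n a)) ∧
      (∀ n, Measurable (aHat n)) ∧ (∀ n, Measurable (pHat n)) ∧
      ∀ (a₀ p₀ : ℝ), 0 < a₀ →
      ∀ (Ω : Type*) [MeasurableSpace Ω] (P : Measure Ω) [IsProbabilityMeasure P]
        (Y Y' : ℕ → Ω → ℝ),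
        (∀ k, HasLaw (Y k) (gaussianReal 0 1) P) →
        (∀ k, HasLaw (Y' k) (gaussianReal 0 1) P) →
        iIndepFun (Sum.elim Y Y') P →
        ∀ y : (n : ℕ) → Ω → PeriodicGaussian.Sample n,
        (∀ n ω, y n ω = PeriodicGaussian.fourierSample n
          (PeriodicGaussian.modelPath n a₀ p₀ (fun k => Y k ω) (fun k => Y' k ω))) →
        -- the estimator of `p₀` when `a₀` is known
        ((∀ᵐ ω ∂P, ∀ n,
            PeriodicGaussian.scoreP (y n ω) a₀ (pKnown n a₀ (y n ω)) = 0 ∧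
            ∀ p, PeriodicGaussian.logLikelihood (y n ω) a₀ p ≤
              PeriodicGaussian.logLikelihood (y n ω) a₀ (pKnown n a₀ (y n ω))) ∧
          (∀ᵐ ω ∂P, Tendsto (fun n => pKnown n a₀ (y n ω)) atTop (𝓝 p₀)) ∧
          TendstoInDistribution
            (fun (n : ℕ) ω => 2 * Real.sqrt (PeriodicGaussian.sumLogSq n) *
              (pKnown n a₀ (y n ω) - p₀))
            atTop (fun z : ℝ => z) (fun _ => P) (gaussianReal 0 1)) ∧
        -- the joint estimator of `(a₀, p₀)`
        ((∀ᵐ ω ∂P, ∀ n, 0 < aHat n (y n ω) ∧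
            PeriodicGaussian.scoreA (y n ω) (aHat n (y n ω)) (pHat n (y n ω)) = 0 ∧
            PeriodicGaussian.scoreP (y n ω) (aHat n (y n ω)) (pHat n (y n ω)) = 0 ∧
            ∀ a p, 0 < a → PeriodicGaussian.logLikelihood (y n ω) a p ≤
              PeriodicGaussian.logLikelihood (y n ω) (aHat n (y n ω)) (pHat n (y n ω))) ∧
          (∀ᵐ ω ∂P, Tendsto (fun n => pHat n (y n ω)) atTop (𝓝 p₀)) ∧
          TendstoInDistribution
            (fun (n : ℕ) ω => (PeriodicGaussian.normMatrix n a₀).mulVec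
              ![aHat n (y n ω) - a₀, pHat n (y n ω) - p₀])
            atTop (fun z : ℝ => z • ![1, -1]) (fun _ => P) (gaussianReal 0 1)) ∧
        -- the same limit when the first estimator is completed by the root in `a`
        ((∀ᵐ ω ∂P, ∀ n, 0 < aKnown n a₀ (y n ω) ∧
            PeriodicGaussian.scoreA (y n ω) (aKnown n a₀ (y n ω)) (pKnown n a₀ (y n ω)) = 0) ∧
          TendstoInDistribution
            (fun (n : ℕ) ω => (PeriodicGaussian.normMatrix n a₀).mulVec
              ![aKnown n a₀ (y n ω) - a₀, pKnown n a₀ (y n ω) - p₀])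
            atTop (fun z : ℝ => z • ![1, -1]) (fun _ => P) (gaussianReal 0 1)) := by
  refine ⟨expKnownScale, fun n a y => scaleOf n (expKnownScale n a y) y,
    fun n y => scaleOf n (expJoint n y) y, expJoint, measurable_expKnownScale,
    fun n a => measurable_scaleOf n (measurable_expKnownScale n a),
    fun n => measurable_scaleOf n (measurable_expJoint n), measurable_expJoint, ?_⟩
  intro a₀ p₀ ha Ω _ P _ Y Y' hY hY' hind y hy
  have hpow : ∀ ω n k, power (y n ω) k =
      2 * (a₀ / ((k : ℕ) : ℝ) ^ p₀) ^ 2 * meanSq Y Y' ω k := fun ω n k => by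
    rw [hy, power_fourierSample_modelPath]
  have hpos := ae_meanSq_pos (Y' := Y') hY
  have hlim := ae_tendsto_sum_meanSq_div hY hY' hind
  have hpower : ∀ᵐ ω ∂P, ∀ n k, 0 < power (y n ω) k :=
    hpos.mono fun ω h n => power_model_pos ha (hpow ω n) h
  have hrootK : ∀ᵐ ω ∂P, ∀ᶠ n : ℕ in atTop, ∑ k ∈ Finset.Icc 1 n, Real.log k *
      ((k : ℝ) ^ (2 * (expKnownScale n a₀ (y n ω) - p₀)) * meanSq Y Y' ω k - 1) = 0 :=
    hpos.mono fun ω h => Eventually.of_forall fun n => root_expKnownScale ha (hpow ω n) h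
  have hrootJ : ∀ᵐ ω ∂P, ∀ᶠ n : ℕ in atTop, ∑ k ∈ Finset.Icc 1 n,
      (Real.log k - sumLog n / n) *
        ((k : ℝ) ^ (2 * (expJoint n (y n ω) - p₀)) * meanSq Y Y' ω k) = 0 :=
    hpos.mono fun ω h => (eventually_ge_atTop 2).mono fun n hn => root_expJoint ha (hpow ω n) h hn
  refine ⟨⟨?_, ?_, tendstoInDistribution_known hY hY' hind ha hy⟩, ⟨?_, ?_, ?_⟩, ?_, ?_⟩
  · filter_upwards [hpower] with ω h n
    exact ⟨scoreP_expKnownScale ha (h n), logLikelihood_le_known ha (h n)⟩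
  · filter_upwards [hlim, hrootK] with ω hl hr
    simpa using (tendsto_zero_of_root (meanSq_nonneg Y Y' ω) hl hr).add_const p₀
  · filter_upwards [hpower] with ω h n
    exact ⟨scaleOf_pos _ _, scoreA_scaleOf (h n) _, scoreP_joint (h n),
      fun a p ha => logLikelihood_le_joint (h n) ha p⟩
  · filter_upwards [hlim, hrootJ] with ω hl hr
    simpa using (tendsto_zero_of_joint_root (meanSq_nonneg Y Y' ω) hl hr).add_const p₀
  · refine tendstoInDistribution_joint hY hY' hind ha hy measurable_expJoint ?_
    filter_upwards [hlim, hrootJ] with ω hz hr l hl hG hE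
    exact tendsto_sqrt_mul_div_log_of_joint_root (meanSq_nonneg Y Y' ω) hz hl hG hE hr
  · filter_upwards [hpower] with ω h n
    exact ⟨scaleOf_pos _ _, scoreA_scaleOf (h n) _⟩
  · refine tendstoInDistribution_joint hY hY' hind ha hy
      (fun n => measurable_expKnownScale n a₀) ?_
    filter_upwards [hlim, hrootK] with ω hz hr l hl hG hE
    exact tendsto_sqrt_mul_div_log_of_root (meanSq_nonneg Y Y' ω) hz hl hG hE hr
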